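/- **Setting.** Let $-1<q<1$, let $\mathcal H_{\mathbb R}$ be a real Hilbert space with complexification $\mathcal H=\mathcal H_{\mathbb R}\otimes_{\mathbb R}\mathbb C$, and let $e\in\mathcal H_{\mathbb R}$ be a unit vector. The $q$-Fock space $\mathcal F_q(\mathcal H_{\mathbb R})$ is the Hilbert space completion of the algebraic direct sum $\bigoplus_{n\ge 0}\mathcal H^{\otimes n}$, $\mathcal H^{\otimes 0}=\mathbb C\Omega$, for the inner product $$\langle e_1\otimes\cdots\otimes e_n,f_1\otimes\cdots\otimes f_m\rangle_q=\delta_{n,m}\sum_{\sigma\in S_n}q^{|\sigma|}\prod_{i=1}^n\langle e_i,f_{\sigma(i)}\rangle ,$$ where $|\sigma|$ is the number of inversions of $\sigma$; the closure of $\mathcal H^{\otimes k}$ in $\mathcal F_q(\mathcal H_{\mathbb R})$ is again denoted $\mathcal H^{\otimes k}$. For $h\in\mathcal H_{\mathbb R}$ let $c(h)$ and $c_r(h)$ be the bounded operators on $\mathcal F_q(\mathcal H_{\mathbb R})$ that tensor a word with $h$ on the left and on the right, respectively, and put $a(h)=c(h)^*$, $a_r(h)=c_r(h)^*$, $s(h)=c(h)+a(h)$.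 Let $M$ be the von Neumann algebra generated by $\{s(h):h\in\mathcal H_{\mathbb R}\}$ and $A\subseteq M$ the von Neumann subalgebra generated by $\{s(h):h\in\mathbb R e\}$; let $L^2(M)=\overline{M\Omega}$ and $L^2(A)=\overline{A\Omega}$, inside $\mathcal F_q(\mathcal H_{\mathbb R})$. For $k\ge 0$ let $$T^k=\{\xi\in\mathcal H^{\otimes k}:a(e)\xi=a_r(e)\xi=0\},$$ and for $\xi\in\mathcal H^{\otimes k}$ and $r,s\ge 0$ put $\xi_{r,s}=e^{\otimes r}\otimes\xi\otimes e^{\otimes s}=c(e)^rc_r(e)^s\xi$. **Theorem 3.11.** There is $\varepsilon>0$ such that for every $q\in(-1,1)$ with $|q|<\varepsilon$ there are constants $A_q,B_q>0$, depending only on $q$, with the following property. Let $\mathcal H_{\mathbb R}$ and $e$ be as above, choose an orthonormal (Hilbert) basis of $T^k$ for every $k\ge 1$, and let $(\xi^i)_{i\in I}$ be the union of these bases. Then all the vectors $\xi^i_{r,s}$ are non-zero, and the normalized vectors $\xi^i_{r,s}/\|\xi^i_{r,s}\|$ ($i\in I$, $r,s\ge 0$) form a Riesz basis of $L^2(M)\ominus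 L^2(A)$, that is: 1. the closed linear span of $\{\xi^i_{r,s}/\|\xi^i_{r,s}\| : i\in I,\ r,s\ge 0\}$ is $L^2(M)\ominus L^2(A)$, the orthogonal complement of $L^2(A)$ in $L^2(M)$; 2. for every family of complex numbers $(\lambda^i_{r,s})$, the series $\sum\lambda^i_{r,s}\xi^i_{r,s}$ converges unconditionally if and only if $\sum|\lambda^i_{r,s}|^2\|\xi^i_{r,s}\|^2<\infty$, and in that case (in particular for finitely supported families) $$A_q\sum_{i,r,s}|\lambda^i_{r,s}|^2\|\xi^i_{r,s}\|^2\le\Big\|\sum_{i,r,s}\lambda^i_{r,s}\xi^i_{r,s}\Big\|^2\le B_q\sum_{i,r,s}|\lambda^i_{r,s}|^2\|\xi^i_{r,s}\|^2 .$$ -/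

import Mathlib

open scoped TensorProduct DirectSum InnerProductSpace ComplexConjugate

noncomputable section

namespace QFock

/-! ### The complexification of a real inner product space -/

/-- The complexification `ℂ ⊗_ℝ V` of a real vector space `V`. -/
def Complexification (V : Type*) [NormedAddCommGroup V] [InnerProductSpace ℝ V] : Type _ :=
  ℂ ⊗[ℝ] V

namespace Complexification

variable {V : Type*} [NormedAddCommGroup V] [InnerProductSpace ℝ V]

instance : AddCommGroup (Complexification V) := inferInstanceAs (AddCommGroup (ℂ ⊗[ℝ] V))
instance : Module ℂ (Complexification V) := inferInstanceAs (Module ℂ (ℂ ⊗[ℝ] V))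

/-- The inclusion `V → ℂ ⊗_ℝ V`, `v ↦ 1 ⊗ v`. -/
def ofReal (v : V) : Complexification V := (1 : ℂ) ⊗ₜ[ℝ] v

/-- The conjugation `z ⊗ v ↦ z̄ ⊗ v`. -/
def conjugation : (ℂ ⊗[ℝ] V) →ₗ[ℝ] (ℂ ⊗[ℝ] V) :=
  LinearMap.rTensor V Complex.conjAe.toLinearMap

/-- The inner product of the complexification, conjugate linear in the first variable:
`⟨z ⊗ v, w ⊗ u⟩ = z̄ w ⟨v, u⟩`. -/
def innerC (x y : ℂ ⊗[ℝ] V) : ℂ :=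
  LinearMap.BilinForm.baseChange ℂ (innerₗ V) (conjugation x) y

theorem innerC_tmul (z w : ℂ) (v u : V) :
    innerC (z ⊗ₜ[ℝ] v) (w ⊗ₜ[ℝ] u) = conj z * w * (inner ℝ v u : ℝ) := by
  simp [innerC, conjugation, mul_comm]

theorem innerC_add_left (x y z : ℂ ⊗[ℝ] V) :
    innerC (x + y) z = innerC x z + innerC y z := by
  simp [innerC]

theorem innerC_add_right (x y z : ℂ ⊗[ℝ] V) :
    innerC x (y + z) = innerC x y + innerC x z := by
  simp [innerC]

theorem innerC_zero_left (x : ℂ ⊗[ℝ] V) : innerC 0 x = 0 := by simp [innerC]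

theorem innerC_zero_right (x : ℂ ⊗[ℝ] V) : innerC x 0 = 0 := by simp [innerC]

theorem exists_eq (x : ℂ ⊗[ℝ] V) :
    ∃ a b : V, x = (1 : ℂ) ⊗ₜ[ℝ] a + Complex.I ⊗ₜ[ℝ] b := by
  induction x with
  | zero => exact ⟨0, 0, by simp⟩
  | tmul z v =>
    refine ⟨z.re • v, z.im • v, ?_⟩
    rw [← TensorProduct.smul_tmul, ← TensorProduct.smul_tmul, ← TensorProduct.add_tmul]
    congr 1
    apply Complex.ext <;> simp
  | add x y hx hy =>
    obtain ⟨a, b, rfl⟩ := hx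
    obtain ⟨c, d, rfl⟩ := hy
    exact ⟨a + c, b + d, by simp only [TensorProduct.tmul_add]; abel⟩

theorem innerC_self (a b : V) :
    innerC ((1 : ℂ) ⊗ₜ[ℝ] a + Complex.I ⊗ₜ[ℝ] b) ((1 : ℂ) ⊗ₜ[ℝ] a + Complex.I ⊗ₜ[ℝ] b)
      = ((‖a‖ ^ 2 + ‖b‖ ^ 2 : ℝ) : ℂ) := by
  simp only [innerC_add_left, innerC_add_right, innerC_tmul, real_inner_self_eq_norm_sq,
    real_inner_comm a b]
  apply Complex.ext <;> simp

theorem innerC_conj_symm (x y : ℂ ⊗[ℝ] V) : conj (innerC y x) = innerC x y := by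
  induction x with
  | zero => simp [innerC_zero_left, innerC_zero_right]
  | add x x' hx hx' => rw [innerC_add_right, map_add, hx, hx', innerC_add_left]
  | tmul z v =>
    induction y with
    | zero => simp [innerC_zero_left, innerC_zero_right]
    | add y y' hy hy' => rw [innerC_add_left, map_add, hy, hy', innerC_add_right]
    | tmul w u =>
      simp only [innerC_tmul, map_mul, Complex.conj_conj, Complex.conj_ofReal,
        real_inner_comm v u]
      ring

theorem innerC_smul_left (x y : ℂ ⊗[ℝ] V) (r : ℂ) :
    innerC (r • x) y = conj r * innerC x y := by
  induction x with
  | zero => simp [innerC_zero_left]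
  | add x x' hx hx' => rw [smul_add, innerC_add_left, hx, hx', innerC_add_left, mul_add]
  | tmul z v =>
    induction y with
    | zero => simp [innerC_zero_right]
    | add y y' hy hy' => rw [innerC_add_right, hy, hy', innerC_add_right, mul_add]
    | tmul w u =>
      rw [TensorProduct.smul_tmul', innerC_tmul, innerC_tmul, smul_eq_mul, map_mul]
      ring

/-- The inner product space structure of the complexification. -/
abbrev core : InnerProductSpace.Core ℂ (Complexification V) where
  inner x y := innerC x y
  conj_inner_symm x y := innerC_conj_symm x y
  re_inner_nonneg x := by
    obtain ⟨a, b, h⟩ := exists_eq (V := V) x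

    rw [h, innerC_self]
    simp only [RCLike.re_eq_complex_re, Complex.ofReal_re]
    positivity
  add_left x y z := innerC_add_left x y z
  smul_left x y r := innerC_smul_left x y r
  definite x hx := by
    obtain ⟨a, b, h⟩ := exists_eq (V := V) x
    change innerC x x = 0 at hx
    rw [h, innerC_self] at hx
    have hx' : ‖a‖ ^ 2 + ‖b‖ ^ 2 = 0 := by exact_mod_cast hx
    have ha : a = 0 := by
      rw [← norm_eq_zero]; nlinarith [sq_nonneg ‖a‖, sq_nonneg ‖b‖]
    have hb : b = 0 := by
      rw [← norm_eq_zero]; nlinarith [sq_nonneg ‖a‖, sq_nonneg ‖b‖]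
    rw [ha, hb] at h
    rw [h]
    simp
    rfl

instance : NormedAddCommGroup (Complexification V) :=
  @InnerProductSpace.Core.toNormedAddCommGroup ℂ _ _ _ _ core

instance : InnerProductSpace ℂ (Complexification V) := InnerProductSpace.ofCore core.toCore

theorem inner_ofReal (v u : V) :
    inner ℂ (ofReal v) (ofReal u) = ((inner ℝ v u : ℝ) : ℂ) := by
  change innerC _ _ = _
  rw [ofReal, ofReal, innerC_tmul]
  simp

end Complexification

/-! ### Inversions of permutations -/

/-- The number of inversions `#{(i, j) : i < j, σ(i) > σ(j)}`. -/
def inversions {n : ℕ} (σ : Equiv.Perm (Fin n)) : ℕ :=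
  (Finset.univ.filter fun p : Fin n × Fin n => p.1 < p.2 ∧ σ p.2 < σ p.1).card

theorem inversions_mul_inv {n : ℕ} (ρ τ : Equiv.Perm (Fin n)) :
    inversions (ρ * τ⁻¹) = (Finset.univ.filter fun p : Fin n × Fin n =>
      p.1 < p.2 ∧ ¬ (τ p.1 < τ p.2 ↔ ρ p.1 < ρ p.2)).card := by
  symm
  unfold inversions
  refine Finset.card_bij'
    (fun p _ => if τ p.1 < τ p.2 then (τ p.1, τ p.2) else (τ p.2, τ p.1))
    (fun p _ => if τ⁻¹ p.1 < τ⁻¹ p.2 then (τ⁻¹ p.1, τ⁻¹ p.2) else (τ⁻¹ p.2, τ⁻¹ p.1)) ?_ ?_ ?_ ?_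
  · rintro ⟨i, j⟩ h
    simp only [Finset.mem_filter, Finset.mem_univ, true_and] at h ⊢
    have h1 : τ i ≠ τ j := fun h' => h.1.ne (τ.injective h')
    have h2 : ρ i ≠ ρ j := fun h' => h.1.ne (ρ.injective h')
    split_ifs with hτ <;> simp <;> grind
  · rintro ⟨a, b⟩ h
    obtain ⟨x, rfl⟩ := τ.surjective a
    obtain ⟨y, rfl⟩ := τ.surjective b
    have hinv : ∀ z, τ⁻¹ (τ z) = z := τ.symm_apply_apply
    have h' := (Finset.mem_filter.1 h).2
    simp only [Equiv.Perm.mul_apply, hinv] at h'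
    have h1 : x ≠ y := fun h1 => h'.1.ne (congrArg τ h1)
    simp only [hinv, Finset.mem_filter, Finset.mem_univ, true_and]
    split_ifs with hτ <;> grind
  · rintro ⟨i, j⟩ h
    simp only [Finset.mem_filter, Finset.mem_univ, true_and] at h ⊢
    split_ifs with hτ <;> simp_all [not_lt_of_gt]
  · rintro ⟨a, b⟩ h
    simp only [Finset.mem_filter, Finset.mem_univ, true_and] at h ⊢
    split_ifs with hτ <;> simp_all [not_lt_of_gt]

theorem inversions_inv {n : ℕ} (σ : Equiv.Perm (Fin n)) : inversions σ⁻¹ = inversions σ := by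
  have h1 := inversions_mul_inv 1 σ
  have h2 := inversions_mul_inv σ 1
  simp only [one_mul, inv_one, mul_one] at h1 h2
  rw [h1, h2]
  simp only [iff_comm]

/-- The order-reversing conjugate of a permutation. -/
def revConj {n : ℕ} (σ : Equiv.Perm (Fin n)) : Equiv.Perm (Fin n) :=
  Fin.revPerm * σ * Fin.revPerm

theorem revConj_revConj {n : ℕ} (σ : Equiv.Perm (Fin n)) : revConj (revConj σ) = σ := by
  ext; simp [revConj]

theorem inversions_revConj {n : ℕ} (σ : Equiv.Perm (Fin n)) :
    inversions (revConj σ) = inversions σ := by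
  unfold inversions
  refine Finset.card_bij' (fun p _ => (p.2.rev, p.1.rev)) (fun p _ => (p.2.rev, p.1.rev))
    ?_ ?_ ?_ ?_ <;> simp +contextual [revConj]

/-- The permutation of `{0, …, n}` with `0 ↦ i` that acts on the remaining points as `τ`. -/
def insertPerm {n : ℕ} (p : Fin (n + 1) × Equiv.Perm (Fin n)) : Equiv.Perm (Fin (n + 1)) :=
  p.1.cycleRange.symm * Equiv.Perm.decomposeFin.symm (0, p.2)

theorem insertPerm_zero {n : ℕ} (p : Fin (n + 1) × Equiv.Perm (Fin n)) :
    insertPerm p 0 = p.1 := by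
  simp [insertPerm]

theorem insertPerm_succ {n : ℕ} (p : Fin (n + 1) × Equiv.Perm (Fin n)) (j : Fin n) :
    insertPerm p j.succ = p.1.succAbove (p.2 j) := by
  simp [insertPerm]

theorem insertPerm_bijective (n : ℕ) : Function.Bijective (insertPerm (n := n)) := by
  rw [Fintype.bijective_iff_injective_and_card]
  refine ⟨?_, by simp [Fintype.card_perm, Nat.factorial_succ]⟩
  rintro ⟨i, τ⟩ ⟨i', τ'⟩ h
  have h0 : i = i' := by
    have := congrArg (fun σ : Equiv.Perm (Fin (n + 1)) => σ 0) h
    simpa [insertPerm_zero] using this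
  subst h0
  congr 1
  ext j
  have := congrArg (fun σ : Equiv.Perm (Fin (n + 1)) => σ j.succ) h
  simp only [insertPerm_succ] at this
  exact congrArg _ (Fin.succAbove_right_injective this)

theorem inversions_eq_sum {n : ℕ} (σ : Equiv.Perm (Fin n)) :
    inversions σ = ∑ i, ∑ j, if i < j ∧ σ j < σ i then 1 else 0 := by
  rw [inversions, Finset.card_filter, Fintype.sum_prod_type]

theorem card_castSucc_lt {n : ℕ} (i : Fin (n + 1)) :
    (Finset.univ.filter fun j : Fin n => j.castSucc < i).card = i := by
  have h : (Finset.univ.filter fun j : Fin n => j.castSucc < i).map Fin.castSuccEmb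
      = Finset.Iio i := by
    ext j
    simp only [Finset.mem_map, Finset.mem_filter, Finset.mem_univ, true_and, Finset.mem_Iio]
    constructor
    · rintro ⟨a, ha, rfl⟩
      exact ha
    · intro hj
      refine ⟨j.castPred (ne_of_lt (lt_of_lt_of_le hj (Fin.le_last i))), ?_, ?_⟩ <;> simp [hj]
  rw [← Finset.card_map, h, Fin.card_Iio]

theorem inversions_insertPerm {n : ℕ} (p : Fin (n + 1) × Equiv.Perm (Fin n)) :
    inversions (insertPerm p) = p.1 + inversions p.2 := by
  obtain ⟨i, τ⟩ := p
  rw [inversions_eq_sum, inversions_eq_sum, Fin.sum_univ_succ]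
  congr 1
  · rw [Fin.sum_univ_succ]
    simp only [insertPerm_zero, insertPerm_succ, Fin.succ_pos, true_and, lt_irrefl, false_and,
      if_false, zero_add]
    rw [Equiv.sum_comp τ (fun j => if i.succAbove j < i then 1 else 0), ← Finset.card_filter]
    simp only [Fin.succAbove_lt_iff_castSucc_lt]
    exact card_castSucc_lt i
  · refine Finset.sum_congr rfl fun a _ => ?_
    rw [Fin.sum_univ_succ]
    simp [insertPerm_succ, Fin.succAbove_lt_succAbove_iff]

/-! ### The `q`-inner product on tensor powers -/

section Tensor

open PiTensorProduct

variable {E : Type*} [NormedAddCommGroup E] [InnerProductSpace ℂ E] {n : ℕ}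

/-- The linear functional `w₁ ⊗ ⋯ ⊗ w_n ↦ ∏ ⟨uᵢ, wᵢ⟩`. -/
def pairing (u : Fin n → E) : (⨂[ℂ]^n E) →ₗ[ℂ] ℂ :=
  lift ((MultilinearMap.mkPiAlgebra ℂ (Fin n) ℂ).compLinearMap fun i => innerₛₗ ℂ (u i))

theorem pairing_tprod (u w : Fin n → E) :
    pairing u (tprod ℂ w) = ∏ i, inner ℂ (u i) (w i) := by
  simp [pairing]

theorem prod_inner_update [DecidableEq (Fin n)] (u w : Fin n → E) (i : Fin n) (x : E) :
    (∏ j, inner ℂ (Function.update u i x j) (w j))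
      = inner ℂ x (w i) * ∏ j ∈ Finset.univ.erase i, inner ℂ (u j) (w j) := by
  rw [← Finset.mul_prod_erase _ _ (Finset.mem_univ i)]
  congr 1
  · simp
  · refine Finset.prod_congr rfl fun j hj => ?_
    rw [Function.update_of_ne (Finset.ne_of_mem_erase hj)]

theorem pairing_update_add [DecidableEq (Fin n)] (u : Fin n → E) (i : Fin n) (x y : E) :
    pairing (Function.update u i (x + y))
      = pairing (Function.update u i x) + pairing (Function.update u i y) := by
  apply PiTensorProduct.ext
  ext w
  simp only [LinearMap.compMultilinearMap_apply, LinearMap.add_apply, pairing_tprod,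
    prod_inner_update, inner_add_left, add_mul]

theorem pairing_update_smul [DecidableEq (Fin n)] (u : Fin n → E) (i : Fin n) (c : ℂ) (x : E) :
    pairing (Function.update u i (c • x)) = conj c • pairing (Function.update u i x) := by
  apply PiTensorProduct.ext
  ext w
  simp only [LinearMap.compMultilinearMap_apply, LinearMap.smul_apply, pairing_tprod,
    prod_inner_update, inner_smul_left, smul_eq_mul, mul_assoc]

/-- `u₁ ⊗ ⋯ ⊗ u_n ↦ (y ↦ conj (∏ ⟨uᵢ, yᵢ⟩))`, as a linear map into the antilinear functionals. -/
def tensorFormAux : (⨂[ℂ]^n E) →ₗ[ℂ] (⨂[ℂ]^n E) →ₗ⋆[ℂ] ℂ :=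
  lift
    { toFun := fun u => (starLinearEquiv ℂ (A := ℂ)).toLinearMap.comp (pairing u)
      map_update_add' := fun u i x y => by
        ext z
        simp [pairing_update_add]
      map_update_smul' := fun u i c x => by
        ext z
        simp [pairing_update_smul] }

/-- The usual inner product on the algebraic tensor power, conjugate linear in the first
variable: `⟨v₁ ⊗ ⋯ ⊗ v_n, w₁ ⊗ ⋯ ⊗ w_n⟩ = ∏ ⟨vᵢ, wᵢ⟩`. -/
def tensorForm (x y : ⨂[ℂ]^n E) : ℂ := tensorFormAux y x

theorem tensorForm_tprod (v w : Fin n → E) :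
    tensorForm (tprod ℂ v) (tprod ℂ w) = ∏ i, inner ℂ (v i) (w i) := by
  simp [tensorForm, tensorFormAux, pairing_tprod]

/-- The action of a permutation, `w₁ ⊗ ⋯ ⊗ w_n ↦ w_{σ(1)} ⊗ ⋯ ⊗ w_{σ(n)}`. -/
def permute (σ : Equiv.Perm (Fin n)) : (⨂[ℂ]^n E) →ₗ[ℂ] (⨂[ℂ]^n E) :=
  (reindex ℂ (fun _ => E) σ.symm).toLinearMap

theorem permute_tprod (σ : Equiv.Perm (Fin n)) (w : Fin n → E) :
    permute σ (tprod ℂ w) = tprod ℂ (fun i => w (σ i)) := by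
  simp [permute]

/-- The `q`-inner product on the algebraic tensor power:
`⟨x, w₁ ⊗ ⋯ ⊗ w_n⟩_q = ∑_σ q^{|σ|} ⟨x, w_{σ(1)} ⊗ ⋯ ⊗ w_{σ(n)}⟩`. -/
def qForm (q : ℝ) (x y : ⨂[ℂ]^n E) : ℂ :=
  ∑ σ : Equiv.Perm (Fin n), (q : ℂ) ^ inversions σ * tensorForm x (permute σ y)

theorem qForm_tprod (q : ℝ) (v w : Fin n → E) :
    qForm q (tprod ℂ v) (tprod ℂ w)
      = ∑ σ : Equiv.Perm (Fin n), (q : ℂ) ^ inversions σ * ∏ i, inner ℂ (v i) (w (σ i)) := by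
  simp [qForm, permute_tprod, tensorForm_tprod]

theorem qForm_add_left (q : ℝ) (x y z : ⨂[ℂ]^n E) :
    qForm q (x + y) z = qForm q x z + qForm q y z := by
  simp [qForm, tensorForm, mul_add, Finset.sum_add_distrib]

theorem qForm_add_right (q : ℝ) (x y z : ⨂[ℂ]^n E) :
    qForm q x (y + z) = qForm q x y + qForm q x z := by
  simp [qForm, tensorForm, mul_add, Finset.sum_add_distrib]

theorem qForm_smul_left (q : ℝ) (x y : ⨂[ℂ]^n E) (r : ℂ) :
    qForm q (r • x) y = conj r * qForm q x y := by
  simp only [qForm, tensorForm, Finset.mul_sum, LinearMap.map_smulₛₗ, smul_eq_mul]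
  exact Finset.sum_congr rfl fun _ _ => by ring

theorem qForm_smul_right (q : ℝ) (x y : ⨂[ℂ]^n E) (r : ℂ) :
    qForm q x (r • y) = r * qForm q x y := by
  simp only [qForm, tensorForm, Finset.mul_sum, map_smul, LinearMap.smul_apply, smul_eq_mul]
  exact Finset.sum_congr rfl fun _ _ => by ring

theorem qForm_zero_left (q : ℝ) (y : ⨂[ℂ]^n E) : qForm q 0 y = 0 := by
  simp [qForm, tensorForm]

theorem qForm_zero_right (q : ℝ) (y : ⨂[ℂ]^n E) : qForm q y 0 = 0 := by
  simp [qForm, tensorForm]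

theorem qForm_sum_left {ι : Type*} (s : Finset ι) (q : ℝ) (f : ι → ⨂[ℂ]^n E) (y : ⨂[ℂ]^n E) :
    qForm q (∑ k ∈ s, f k) y = ∑ k ∈ s, qForm q (f k) y := by
  classical
  induction s using Finset.induction_on with
  | empty => simp [qForm_zero_left]
  | insert a s ha ih => rw [Finset.sum_insert ha, Finset.sum_insert ha, qForm_add_left, ih]

theorem qForm_sum_right {ι : Type*} (s : Finset ι) (q : ℝ) (f : ι → ⨂[ℂ]^n E) (y : ⨂[ℂ]^n E) :
    qForm q y (∑ k ∈ s, f k) = ∑ k ∈ s, qForm q y (f k) := by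
  classical
  induction s using Finset.induction_on with
  | empty => simp [qForm_zero_right]
  | insert a s ha ih => rw [Finset.sum_insert ha, Finset.sum_insert ha, qForm_add_right, ih]

theorem qForm_conj_symm (q : ℝ) (x y : ⨂[ℂ]^n E) : conj (qForm q y x) = qForm q x y := by
  induction x using PiTensorProduct.induction_on with
  | add x x' hx hx' => rw [qForm_add_right, map_add, hx, hx', qForm_add_left]
  | smul_tprod r v =>
    rw [qForm_smul_right, qForm_smul_left, map_mul]
    congr 1
    induction y using PiTensorProduct.induction_on with
    | add y y' hy hy' => rw [qForm_add_left, map_add, hy, hy', qForm_add_right]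
    | smul_tprod r w =>
      rw [qForm_smul_right, qForm_smul_left, map_mul, Complex.conj_conj]
      congr 1
      rw [qForm_tprod, qForm_tprod, map_sum, ← Equiv.sum_comp (Equiv.inv (Equiv.Perm (Fin n)))]
      refine Finset.sum_congr rfl fun σ _ => ?_
      simp only [Equiv.inv_apply, inversions_inv, map_mul, map_pow, Complex.conj_ofReal, map_prod,
        inner_conj_symm]
      congr 1
      rw [← Equiv.prod_comp σ]
      refine Finset.prod_congr rfl fun i _ => ?_
      rw [show (Equiv.inv (Equiv.Perm (Fin n)) σ) (σ i) = i from σ.symm_apply_apply i]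

theorem exists_sum_tprod (x : ⨂[ℂ]^n E) :
    ∃ (m : ℕ) (c : Fin m → ℂ) (v : Fin m → Fin n → E), x = ∑ k, c k • tprod ℂ (v k) := by
  induction x using PiTensorProduct.induction_on with
  | smul_tprod r f => exact ⟨1, fun _ => r, fun _ => f, by simp⟩
  | add x y hx hy =>
    obtain ⟨m, c, v, rfl⟩ := hx
    obtain ⟨m', c', v', rfl⟩ := hy
    refine ⟨m + m', Fin.append c c', Fin.append v v', ?_⟩
    simp [Fin.sum_univ_add]

open Matrix ComplexOrder in
theorem posSemidef_prod {ι κ : Type*} [Fintype ι] (s : Finset κ)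
    (M : κ → Matrix ι ι ℂ) (hM : ∀ k ∈ s, (M k).PosSemidef) :
    (Matrix.of fun a b => ∏ k ∈ s, M k a b).PosSemidef := by
  classical
  induction s using Finset.induction_on with
  | empty =>
    have : (Matrix.of fun a b => ∏ k ∈ (∅ : Finset κ), M k a b : Matrix ι ι ℂ)
        = vecMulVec (fun _ => 1) (star fun _ => 1) := by
      ext a b
      simp [vecMulVec_apply]
    rw [this]
    exact posSemidef_vecMulVec_self_star _
  | insert k s hk ih =>
    have := (hM k (Finset.mem_insert_self k s)).hadamard
      (ih fun k' hk' => hM k' (Finset.mem_insert_of_mem hk'))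
    have e : (Matrix.of fun a b => ∏ k ∈ insert k s, M k a b : Matrix ι ι ℂ)
        = M k ⊙ Matrix.of fun a b => ∏ k ∈ s, M k a b := by
      ext a b
      simp [Finset.prod_insert hk]
    rw [e]
    exact this

open Matrix ComplexOrder in
theorem posSemidef_sign {ι : Type*} [Fintype ι] (q : ℝ) (h1 : -1 < q) (h2 : q < 1)
    (P : ι → Prop) [DecidablePred P] :
    (Matrix.of fun a b : ι => if ¬ (P a ↔ P b) then (q : ℂ) else 1).PosSemidef := by
  have key : (Matrix.of fun a b : ι => if ¬ (P a ↔ P b) then (q : ℂ) else 1)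
      = ((1 + q) / 2 : ℝ) • vecMulVec (fun _ => (1 : ℂ)) (star fun _ => (1 : ℂ))
        + ((1 - q) / 2 : ℝ) • vecMulVec (fun a => if P a then (1 : ℂ) else -1)
            (star fun a => if P a then (1 : ℂ) else -1) := by
    ext a b
    by_cases ha : P a <;> by_cases hb : P b <;>
      simp [vecMulVec_apply, ha, hb] <;> ring
  rw [key]
  exact ((posSemidef_vecMulVec_self_star _).smul (by linarith)).add
    ((posSemidef_vecMulVec_self_star _).smul (by linarith))

open Matrix ComplexOrder in
/-- The matrix whose entries sum up to `n!` times the `q`-norm square of a tensor. -/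
theorem posSemidef_kernel {m : ℕ} (q : ℝ) (h1 : -1 < q) (h2 : q < 1) (v : Fin m → Fin n → E) :
    (Matrix.of fun a b : Fin m × Equiv.Perm (Fin n) => (q : ℂ) ^ inversions (b.2 * a.2⁻¹) *
      ∏ i, inner ℂ (v a.1 (a.2 i)) (v b.1 (b.2 i))).PosSemidef := by
  have hA := posSemidef_prod (ι := Fin m × Equiv.Perm (Fin n))
    (Finset.univ.filter fun p : Fin n × Fin n => p.1 < p.2)
    (fun p => Matrix.of fun a b =>
      if ¬ (a.2 p.1 < a.2 p.2 ↔ b.2 p.1 < b.2 p.2) then (q : ℂ) else 1)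
    (fun p _ => posSemidef_sign q h1 h2 (fun a : Fin m × Equiv.Perm (Fin n) => a.2 p.1 < a.2 p.2))
  have hB := posSemidef_prod (ι := Fin m × Equiv.Perm (Fin n)) (Finset.univ : Finset (Fin n))
    (fun i => Matrix.gram ℂ fun a => v a.1 (a.2 i)) (fun i _ => posSemidef_gram _ _)
  have hAB := hA.hadamard hB
  refine (congrArg Matrix.PosSemidef ?_).mp hAB
  ext a b
  simp only [of_apply, hadamard_apply, gram_apply]
  congr 1
  rw [inversions_mul_inv, Finset.prod_ite, Finset.prod_const, Finset.prod_const_one, mul_one,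
    Finset.filter_filter]

open Matrix ComplexOrder in
theorem qForm_self_nonneg (q : ℝ) (h1 : -1 < q) (h2 : q < 1) (x : ⨂[ℂ]^n E) :
    0 ≤ (qForm q x x).re := by
  obtain ⟨m, c, v, rfl⟩ := exists_sum_tprod x
  have h := (posSemidef_kernel q h1 h2 v).dotProduct_mulVec_nonneg (fun a => c a.1)
  have key : star (fun a : Fin m × Equiv.Perm (Fin n) => c a.1) ⬝ᵥ
      ((Matrix.of fun a b : Fin m × Equiv.Perm (Fin n) => (q : ℂ) ^ inversions (b.2 * a.2⁻¹) *
        ∏ i, inner ℂ (v a.1 (a.2 i)) (v b.1 (b.2 i))) *ᵥ fun a => c a.1)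
      = (n.factorial : ℂ) *
        qForm q (∑ k, c k • tprod ℂ (v k)) (∑ k, c k • tprod ℂ (v k)) := by
    rw [qForm_sum_left]
    simp only [dotProduct, mulVec, Fintype.sum_prod_type, Pi.star_apply, of_apply,
      qForm_sum_right, qForm_smul_left, qForm_smul_right, qForm_tprod]
    rw [Finset.mul_sum]
    refine Finset.sum_congr rfl fun k _ => ?_
    have : ∀ τ : Equiv.Perm (Fin n), (∑ l, ∑ ρ : Equiv.Perm (Fin n),
        (q : ℂ) ^ inversions (ρ * τ⁻¹) * (∏ i, inner ℂ (v k (τ i)) (v l (ρ i))) * c l)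
        = ∑ l, c l * ∑ σ : Equiv.Perm (Fin n),
            (q : ℂ) ^ inversions σ * ∏ i, inner ℂ (v k i) (v l (σ i)) := by
      intro τ
      refine Finset.sum_congr rfl fun l _ => ?_
      rw [← Equiv.sum_comp (Equiv.mulRight τ), Finset.mul_sum]
      refine Finset.sum_congr rfl fun σ _ => ?_
      rw [← Equiv.prod_comp τ (fun i => inner ℂ (v k i) (v l (σ i)))]
      simp only [Equiv.coe_mulRight, mul_inv_cancel_right, Equiv.Perm.mul_apply]
      ring
    simp only [this, Finset.sum_const, Finset.card_univ, Fintype.card_perm, Fintype.card_fin,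
      nsmul_eq_mul, Finset.mul_sum]
    simp only [RCLike.star_def]
    exact Finset.sum_congr rfl fun _ _ => Finset.sum_congr rfl fun _ _ => by ring
  rw [key] at h
  have h' := (Complex.le_def.1 h).1
  simp only [Complex.zero_re, Complex.mul_re, Complex.natCast_re, Complex.natCast_im, zero_mul,
    sub_zero] at h'
  exact nonneg_of_mul_nonneg_right h' (by exact_mod_cast n.factorial_pos)

/-- Creation on the left, `w₁ ⊗ ⋯ ⊗ w_n ↦ h ⊗ w₁ ⊗ ⋯ ⊗ w_n`. -/
def tensorCons (h : E) : (⨂[ℂ]^n E) →ₗ[ℂ] (⨂[ℂ]^(n + 1) E) :=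
  lift ((tprod ℂ : MultilinearMap ℂ (fun _ : Fin (n + 1) => E) _).curryLeft h)

theorem tensorCons_tprod (h : E) (w : Fin n → E) :
    tensorCons h (tprod ℂ w) = tprod ℂ (Fin.cons h w : Fin (n + 1) → E) := by
  simp [tensorCons]

/-- Creation on the right, `w₁ ⊗ ⋯ ⊗ w_n ↦ w₁ ⊗ ⋯ ⊗ w_n ⊗ h`. -/
def tensorSnoc (h : E) : (⨂[ℂ]^n E) →ₗ[ℂ] (⨂[ℂ]^(n + 1) E) :=
  lift ((LinearMap.applyₗ h).compMultilinearMap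
    (tprod ℂ : MultilinearMap ℂ (fun _ : Fin (n + 1) => E) _).curryRight)

theorem tensorSnoc_tprod (h : E) (w : Fin n → E) :
    tensorSnoc h (tprod ℂ w) = tprod ℂ (Fin.snoc w h : Fin (n + 1) → E) := by
  simp [tensorSnoc]

/-- `w₀ ⊗ ⋯ ⊗ w_n ↦ ∑ᵢ qⁱ ⟨h, wᵢ⟩ w₀ ⊗ ⋯ ŵᵢ ⋯ ⊗ w_n`. -/
def tensorAnn (q : ℝ) (h : E) : (⨂[ℂ]^(n + 1) E) →ₗ[ℂ] (⨂[ℂ]^n E) :=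
  ∑ i : Fin (n + 1), (q : ℂ) ^ (i : ℕ) •
    lift (LinearMap.uncurryMid i ((innerₛₗ ℂ h).smulRight
      (tprod ℂ : MultilinearMap ℂ (fun _ : Fin n => E) _)))

theorem tensorAnn_tprod (q : ℝ) (h : E) (w : Fin (n + 1) → E) :
    tensorAnn q h (tprod ℂ w)
      = ∑ i : Fin (n + 1), (q : ℂ) ^ (i : ℕ) • inner ℂ h (w i) • tprod ℂ (i.removeNth w) := by
  simp [tensorAnn]

theorem qForm_tensorCons (q : ℝ) (h : E) (x : ⨂[ℂ]^n E) (y : ⨂[ℂ]^(n + 1) E) :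
    qForm q (tensorCons h x) y = qForm q x (tensorAnn q h y) := by
  induction x using PiTensorProduct.induction_on with
  | add x x' hx hx' => rw [map_add, qForm_add_left, hx, hx', qForm_add_left]
  | smul_tprod r v =>
    change Fin n → E at v
    rw [map_smul, qForm_smul_left, qForm_smul_left]
    congr 1
    induction y using PiTensorProduct.induction_on with
    | add y y' hy hy' => rw [map_add, qForm_add_right, hy, hy', qForm_add_right]
    | smul_tprod r w =>
      change Fin (n + 1) → E at w
      rw [map_smul, qForm_smul_right, qForm_smul_right]
      congr 1
      rw [tensorCons_tprod, qForm_tprod, tensorAnn_tprod, qForm_sum_right,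
        ← (insertPerm_bijective n).sum_comp, Fintype.sum_prod_type]
      refine Finset.sum_congr rfl fun i _ => ?_
      rw [qForm_smul_right, qForm_smul_right, qForm_tprod, Finset.mul_sum, Finset.mul_sum]
      refine Finset.sum_congr rfl fun τ _ => ?_
      rw [inversions_insertPerm, Fin.prod_univ_succ, pow_add]
      simp only [Fin.cons_zero, Fin.cons_succ, insertPerm_zero, insertPerm_succ,
        Fin.removeNth_apply]
      ring

theorem tensorAnn_tensorCons_zero (q : ℝ) (h : E) (y : ⨂[ℂ]^0 E) :
    tensorAnn q h (tensorCons h y) = inner ℂ h h • y := by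
  induction y using PiTensorProduct.induction_on with
  | add y y' hy hy' => rw [map_add, map_add, hy, hy', smul_add]
  | smul_tprod r w =>
    rw [map_smul, map_smul, tensorCons_tprod, tensorAnn_tprod, smul_comm]
    simp

theorem tensorAnn_tensorCons (q : ℝ) (h : E) (y : ⨂[ℂ]^(n + 1) E) :
    tensorAnn q h (tensorCons h y) = inner ℂ h h • y + (q : ℂ) • tensorCons h (tensorAnn q h y) := by
  induction y using PiTensorProduct.induction_on with
  | add y y' hy hy' =>
    simp only [map_add, hy, hy', smul_add]
    abel
  | smul_tprod r w =>
    simp only [map_smul]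
    rw [smul_comm (inner ℂ h h) r, smul_comm (q : ℂ) r, ← smul_add]
    congr 1
    rw [tensorCons_tprod, tensorAnn_tprod, Fin.sum_univ_succ, tensorAnn_tprod, map_sum,
      Finset.smul_sum]
    congr 1
    · simp
    · refine Finset.sum_congr rfl fun i _ => ?_
      have : (Fin.succ i).removeNth (Fin.cons h w : Fin (n + 2) → E)
          = (Fin.cons h (i.removeNth w) : Fin (n + 1) → E) := by
        funext j
        refine Fin.cases ?_ (fun j => ?_) j <;> simp [Fin.removeNth]
      rw [this]
      simp only [map_smul, tensorCons_tprod, Fin.val_succ, pow_succ', Fin.cons_succ, smul_smul]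
      congr 1
      ring

/-- The flip `w₁ ⊗ ⋯ ⊗ w_n ↦ w_n ⊗ ⋯ ⊗ w₁`. -/
def tensorFlip : (⨂[ℂ]^n E) →ₗ[ℂ] (⨂[ℂ]^n E) := permute Fin.revPerm

theorem tensorFlip_tprod (w : Fin n → E) :
    tensorFlip (tprod ℂ w) = tprod ℂ (fun i => w i.rev) := by
  simp [tensorFlip, permute_tprod]

theorem qForm_tensorFlip (q : ℝ) (x y : ⨂[ℂ]^n E) :
    qForm q (tensorFlip x) (tensorFlip y) = qForm q x y := by
  induction x using PiTensorProduct.induction_on with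
  | add x x' hx hx' => rw [map_add, qForm_add_left, hx, hx', qForm_add_left]
  | smul_tprod r v =>
    change Fin n → E at v
    rw [map_smul, qForm_smul_left, qForm_smul_left]
    congr 1
    induction y using PiTensorProduct.induction_on with
    | add y y' hy hy' => rw [map_add, qForm_add_right, hy, hy', qForm_add_right]
    | smul_tprod r w =>
      change Fin n → E at w
      rw [map_smul, qForm_smul_right, qForm_smul_right]
      congr 1
      rw [tensorFlip_tprod, tensorFlip_tprod, qForm_tprod, qForm_tprod]
      refine Finset.sum_bij' (fun σ _ => revConj σ) (fun σ _ => revConj σ) (by simp) (by simp)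
        (fun σ _ => revConj_revConj σ) (fun σ _ => revConj_revConj σ) fun σ _ => ?_
      rw [inversions_revConj, ← Equiv.prod_comp Fin.revPerm]
      simp [revConj]

theorem tensorSnoc_eq (h : E) (x : ⨂[ℂ]^n E) :
    tensorSnoc h x = tensorFlip (tensorCons h (tensorFlip x)) := by
  induction x using PiTensorProduct.induction_on with
  | add x x' hx hx' => simp only [map_add, hx, hx']
  | smul_tprod r v =>
    change Fin n → E at v
    simp only [map_smul]
    congr 1
    rw [tensorFlip_tprod, tensorCons_tprod, tensorSnoc_tprod, tensorFlip_tprod]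
    congr 1
    funext i
    refine Fin.lastCases ?_ (fun j => ?_) i <;> simp [Fin.rev_castSucc]

end Tensor

/-! ### The `q`-Fock space -/

section Fock

variable {E : Type*} [NormedAddCommGroup E] [InnerProductSpace ℂ E]
variable (q : Set.Ioo (-1 : ℝ) 1)

/-- The algebraic Fock space `⨁ₙ E^{⊗ n}`; the parameter `q` only selects the inner product. -/
def AlgFock (_q : Set.Ioo (-1 : ℝ) 1) (E : Type*) [NormedAddCommGroup E]
    [InnerProductSpace ℂ E] : Type _ :=
  ⨁ n : ℕ, ⨂[ℂ]^n E

instance : AddCommGroup (AlgFock q E) := inferInstanceAs (AddCommGroup (⨁ n : ℕ, ⨂[ℂ]^n E))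
instance : Module ℂ (AlgFock q E) := inferInstanceAs (Module ℂ (⨁ n : ℕ, ⨂[ℂ]^n E))

namespace AlgFock

variable {q}

/-- The inclusion of `E^{⊗ n}`. -/
def of (n : ℕ) : (⨂[ℂ]^n E) →ₗ[ℂ] AlgFock q E :=
  DirectSum.lof ℂ ℕ (fun n => ⨂[ℂ]^n E) n

/-- The component in `E^{⊗ n}`. -/
def component (n : ℕ) : AlgFock q E →ₗ[ℂ] (⨂[ℂ]^n E) :=
  DirectSum.component ℂ ℕ (fun n => ⨂[ℂ]^n E) n

theorem ext_component {x y : AlgFock q E} (h : ∀ n, component n x = component n y) : x = y :=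
  DFinsupp.ext h

theorem component_of_self (n : ℕ) (x : ⨂[ℂ]^n E) :
    component n (of n x : AlgFock q E) = x :=
  by
  change (DirectSum.lof ℂ ℕ (fun n => ⨂[ℂ]^n E) n x) n = x
  rw [DirectSum.lof_eq_of, DirectSum.of_eq_same]

theorem component_of_ne {n m : ℕ} (h : n ≠ m) (x : ⨂[ℂ]^n E) :
    component m (of n x : AlgFock q E) = 0 := by
  change (DirectSum.lof ℂ ℕ (fun n => ⨂[ℂ]^n E) n x) m = 0
  rw [DirectSum.lof_eq_of]
  exact DirectSum.of_eq_of_ne _ _ _ h.symm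

@[elab_as_elim]
theorem induction_on {p : AlgFock q E → Prop} (x : AlgFock q E) (h0 : p 0)
    (hof : ∀ n (t : ⨂[ℂ]^n E), p (of n t)) (hadd : ∀ x y, p x → p y → p (x + y)) : p x :=
  DirectSum.induction_on x h0 hof hadd

theorem exists_bound (x : AlgFock q E) : ∃ N, ∀ n, N ≤ n → component n x = 0 := by
  refine induction_on x ⟨0, fun n _ => map_zero _⟩ (fun m t => ?_) ?_
  · refine ⟨m + 1, fun n hn => ?_⟩
    exact component_of_ne (by omega) t
  · rintro x y ⟨N, hN⟩ ⟨M, hM⟩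
    refine ⟨max N M, fun n hn => ?_⟩
    rw [map_add, hN n (le_trans (le_max_left _ _) hn), hM n (le_trans (le_max_right _ _) hn),
      add_zero]

/-- The `q`-inner product `⟨x, y⟩_q = ∑ₙ ⟨xₙ, yₙ⟩_q` (a finite sum) on the algebraic Fock space. -/
def form (x y : AlgFock q E) : ℂ :=
  ∑ᶠ n, qForm (q : ℝ) (component n x) (component n y)

theorem form_eq_sum (x y : AlgFock q E) (N : ℕ) (h : ∀ n, N ≤ n → component n y = 0) :
    form x y = ∑ n ∈ Finset.range N, qForm (q : ℝ) (component n x) (component n y) := by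
  refine finsum_eq_sum_of_support_subset _ fun n hn => ?_
  by_contra hn'
  simp only [Finset.coe_range, Set.mem_Iio, not_lt] at hn'
  exact hn (by simp only [h n hn', qForm_zero_right])

theorem form_conj_symm (x y : AlgFock q E) : conj (form y x) = form x y := by
  obtain ⟨N, hN⟩ := exists_bound x
  obtain ⟨M, hM⟩ := exists_bound y
  rw [form_eq_sum y x (max N M) fun n hn => hN n (le_trans (le_max_left _ _) hn),
    form_eq_sum x y (max N M) fun n hn => hM n (le_trans (le_max_right _ _) hn), map_sum]
  exact Finset.sum_congr rfl fun n _ => qForm_conj_symm _ _ _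

theorem form_add_left (x y z : AlgFock q E) : form (x + y) z = form x z + form y z := by
  obtain ⟨N, hN⟩ := exists_bound z
  simp only [form_eq_sum _ z N hN, map_add, qForm_add_left, Finset.sum_add_distrib]

theorem form_smul_left (x y : AlgFock q E) (r : ℂ) : form (r • x) y = conj r * form x y := by
  obtain ⟨N, hN⟩ := exists_bound y
  simp only [form_eq_sum _ y N hN, map_smul, qForm_smul_left, Finset.mul_sum]

theorem form_self_nonneg (x : AlgFock q E) : 0 ≤ (form x x).re := by
  obtain ⟨N, hN⟩ := exists_bound x
  rw [form_eq_sum _ x N hN, Complex.re_sum]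
  exact Finset.sum_nonneg fun n _ => qForm_self_nonneg _ q.2.1 q.2.2 _

/-- The `q`-inner product is a positive semidefinite hermitian form. -/
abbrev core : PreInnerProductSpace.Core ℂ (AlgFock q E) where
  inner x y := form x y
  conj_inner_symm x y := form_conj_symm x y
  re_inner_nonneg x := form_self_nonneg x
  add_left x y z := form_add_left x y z
  smul_left x y r := form_smul_left x y r

instance : SeminormedAddCommGroup (AlgFock q E) :=
  @InnerProductSpace.Core.toSeminormedAddCommGroup ℂ _ _ _ _ core

instance : InnerProductSpace ℂ (AlgFock q E) := InnerProductSpace.ofCore core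

theorem inner_eq_form (x y : AlgFock q E) : inner ℂ x y = form x y := rfl

theorem inner_of_of (n : ℕ) (x y : ⨂[ℂ]^n E) :
    inner ℂ (of n x : AlgFock q E) (of n y) = qForm (q : ℝ) x y := by
  rw [inner_eq_form, form, finsum_eq_single _ n]
  · rw [component_of_self, component_of_self]
  · intro m hm
    rw [component_of_ne hm.symm, qForm_zero_left]

theorem inner_of_of_ne {n m : ℕ} (h : n ≠ m) (x : ⨂[ℂ]^n E) (y : ⨂[ℂ]^m E) :
    inner ℂ (of n x : AlgFock q E) (of m y) = 0 := by
  rw [inner_eq_form, form, finsum_eq_zero_of_forall_eq_zero]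
  intro k
  by_cases hk : n = k
  · subst hk
    rw [component_of_ne h.symm, qForm_zero_right]
  · rw [component_of_ne hk, qForm_zero_left]

/-- The graded linear map with the given components. -/
def graded {d : ℕ → ℕ} (T : ∀ n, (⨂[ℂ]^n E) →ₗ[ℂ] (⨂[ℂ]^(d n) E)) :
    AlgFock q E →ₗ[ℂ] AlgFock q E :=
  DirectSum.toModule ℂ ℕ (AlgFock q E) fun n => (of (d n)).comp (T n)

theorem graded_of {d : ℕ → ℕ} (T : ∀ n, (⨂[ℂ]^n E) →ₗ[ℂ] (⨂[ℂ]^(d n) E)) (n : ℕ)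
    (x : ⨂[ℂ]^n E) : graded T (of n x : AlgFock q E) = of (d n) (T n x) := by
  change DirectSum.toModule ℂ ℕ (AlgFock q E) (fun n => (of (d n)).comp (T n))
    (DirectSum.lof ℂ ℕ (fun n => ⨂[ℂ]^n E) n x) = _
  rw [DirectSum.toModule_lof]
  rfl

/-- The left creation operator on the algebraic Fock space:
`w₁ ⊗ ⋯ ⊗ w_n ↦ h ⊗ w₁ ⊗ ⋯ ⊗ w_n`. -/
def create (h : E) : AlgFock q E →ₗ[ℂ] AlgFock q E := graded fun _ => tensorCons h

/-- The right creation operator on the algebraic Fock space: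
`w₁ ⊗ ⋯ ⊗ w_n ↦ w₁ ⊗ ⋯ ⊗ w_n ⊗ h`. -/
def createR (h : E) : AlgFock q E →ₗ[ℂ] AlgFock q E := graded fun _ => tensorSnoc h

/-- The flip `w₁ ⊗ ⋯ ⊗ w_n ↦ w_n ⊗ ⋯ ⊗ w₁`. -/
def flip : AlgFock q E →ₗ[ℂ] AlgFock q E := graded fun _ => tensorFlip

/-- The components of the left annihilation operator. -/
def annAux (h : E) : ∀ n : ℕ, (⨂[ℂ]^n E) →ₗ[ℂ] AlgFock q E
  | 0 => 0
  | n + 1 => (of n).comp (tensorAnn (q : ℝ) h)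

/-- The left annihilation operator on the algebraic Fock space. -/
def ann (h : E) : AlgFock q E →ₗ[ℂ] AlgFock q E :=
  DirectSum.toModule ℂ ℕ (AlgFock q E) (annAux h)

theorem ann_of (h : E) (n : ℕ) (x : ⨂[ℂ]^n E) : ann h (of n x : AlgFock q E) = annAux h n x := by
  change DirectSum.toModule ℂ ℕ (AlgFock q E) (annAux h)
    (DirectSum.lof ℂ ℕ (fun n => ⨂[ℂ]^n E) n x) = _
  rw [DirectSum.toModule_lof]

theorem ann_of_zero (h : E) (x : ⨂[ℂ]^0 E) : ann h (of 0 x : AlgFock q E) = 0 := by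
  rw [ann_of]
  rfl

theorem ann_of_succ (h : E) (n : ℕ) (x : ⨂[ℂ]^(n + 1) E) :
    ann h (of (n + 1) x : AlgFock q E) = of n (tensorAnn (q : ℝ) h x) := by
  rw [ann_of]
  rfl

theorem component_ann (h : E) (n : ℕ) (x : AlgFock q E) :
    component n (ann h x) = tensorAnn (q : ℝ) h (component (n + 1) x) := by
  refine induction_on x (by simp) (fun m t => ?_) fun x y hx hy => by simp [hx, hy]
  rcases m with _ | m
  · rw [ann_of_zero, component_of_ne (by omega), map_zero, map_zero]
  · rw [ann_of_succ]
    by_cases hm : m = n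
    · subst hm
      rw [component_of_self, component_of_self]
    · rw [component_of_ne hm, component_of_ne (by omega), map_zero]

theorem inner_create (h : E) (x y : AlgFock q E) :
    inner ℂ (create h x) y = inner ℂ x (ann h y) := by
  refine induction_on x (by simp) (fun n s => ?_) fun x x' hx hx' => by
    rw [map_add, inner_add_left, inner_add_left, hx, hx']
  refine induction_on y (by simp) (fun m t => ?_) fun y y' hy hy' => by
    rw [map_add, inner_add_right, inner_add_right, hy, hy']
  rw [create, graded_of]
  rcases m with _ | m
  · rw [ann_of_zero, inner_zero_right, inner_of_of_ne (by omega)]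
  · rw [ann_of_succ]
    by_cases hm : n = m
    · subst hm
      rw [inner_of_of, inner_of_of, qForm_tensorCons]
    · rw [inner_of_of_ne (by omega), inner_of_of_ne hm]

theorem ann_create (h : E) (x : AlgFock q E) :
    ann h (create h x) = inner ℂ h h • x + ((q : ℝ) : ℂ) • create h (ann h x) := by
  refine induction_on x (by simp) (fun n s => ?_) fun x x' hx hx' => by
    simp only [map_add, hx, hx', smul_add]; abel
  rw [create, graded_of, ann_of_succ]
  rcases n with _ | n
  · rw [ann_of_zero, map_zero, smul_zero, add_zero, tensorAnn_tensorCons_zero, map_smul]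
  · rw [ann_of_succ, graded_of, tensorAnn_tensorCons, map_add, map_smul, map_smul]

theorem inner_flip (x y : AlgFock q E) : inner ℂ (flip x) (flip y) = inner ℂ x y := by
  refine induction_on x (by simp) (fun n s => ?_) fun x x' hx hx' => by
    rw [map_add, inner_add_left, inner_add_left, hx, hx']
  refine induction_on y (by simp) (fun m t => ?_) fun y y' hy hy' => by
    rw [map_add, inner_add_right, inner_add_right, hy, hy']
  rw [flip, graded_of, graded_of]
  by_cases hm : n = m
  · subst hm
    rw [inner_of_of, inner_of_of, qForm_tensorFlip]
  · rw [inner_of_of_ne hm, inner_of_of_ne hm]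

theorem createR_eq (h : E) (x : AlgFock q E) : createR h x = flip (create h (flip x)) := by
  refine induction_on x (by simp) (fun n s => ?_) fun x x' hx hx' => by
    simp only [map_add, hx, hx']
  rw [createR, flip, create, graded_of, graded_of, graded_of, graded_of, tensorSnoc_eq]

theorem norm_flip (x : AlgFock q E) : ‖flip x‖ = ‖x‖ := by
  rw [norm_eq_sqrt_re_inner (𝕜 := ℂ), inner_flip, ← norm_eq_sqrt_re_inner]

theorem norm_create_sq (h : E) (x : AlgFock q E) :
    ‖create h x‖ ^ 2 = ‖h‖ ^ 2 * ‖x‖ ^ 2 + (q : ℝ) * ‖ann h x‖ ^ 2 := by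
  have e : (inner ℂ (create h x) (create h x) : ℂ)
      = inner ℂ h h * inner ℂ x x + ((q : ℝ) : ℂ) * inner ℂ (ann h x) (ann h x) := by
    rw [inner_create, ann_create, inner_add_right, inner_smul_right, inner_smul_right,
      ← inner_conj_symm x (create h (ann h x)), inner_create, inner_conj_symm]
  simp only [inner_self_eq_norm_sq_to_K] at e
  have e' : ((‖create h x‖ ^ 2 : ℝ) : ℂ)
      = ((‖h‖ ^ 2 * ‖x‖ ^ 2 + (q : ℝ) * ‖ann h x‖ ^ 2 : ℝ) : ℂ) := by
    push_cast
    exact e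
  exact Complex.ofReal_injective e'

/-- The square of the norm bound of the creation operators. -/
def bound (q : Set.Ioo (-1 : ℝ) 1) (h : E) : ℝ := ‖h‖ ^ 2 / (1 - |(q : ℝ)|)

theorem one_sub_abs_pos (q : Set.Ioo (-1 : ℝ) 1) : 0 < 1 - |(q : ℝ)| := by
  have := abs_lt.2 q.2
  linarith

theorem bound_nonneg (h : E) : 0 ≤ bound q h :=
  div_nonneg (sq_nonneg _) (one_sub_abs_pos q).le

theorem norm_create_sq_le (h : E) (N : ℕ) (x : AlgFock q E)
    (hx : ∀ n, N ≤ n → component n x = 0) : ‖create h x‖ ^ 2 ≤ bound q h * ‖x‖ ^ 2 := by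
  induction N generalizing x with
  | zero =>
    have : x = 0 := ext_component fun n => by rw [hx n (Nat.zero_le n), map_zero]
    rw [this]
    simp
  | succ N ih =>
    have hann := ih (ann h x) fun n hn => by rw [component_ann, hx _ (by omega), map_zero]
    have hK := bound_nonneg (q := q) h
    have h1 : ‖ann h x‖ ^ 2 ≤ bound q h * ‖x‖ ^ 2 := by
      have h2 : ‖ann h x‖ ^ 2 ≤ ‖create h (ann h x)‖ * ‖x‖ := by
        have e : (inner ℂ (create h (ann h x)) x : ℂ) = (‖ann h x‖ : ℂ) ^ 2 := by
          rw [inner_create]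
          exact inner_self_eq_norm_sq_to_K _
        have := norm_inner_le_norm (𝕜 := ℂ) (create h (ann h x)) x
        rw [e] at this
        simpa using this
      have h3 : (‖ann h x‖ ^ 2) ^ 2 ≤ (bound q h * ‖ann h x‖ ^ 2) * ‖x‖ ^ 2 :=
        calc (‖ann h x‖ ^ 2) ^ 2 ≤ (‖create h (ann h x)‖ * ‖x‖) ^ 2 :=
              pow_le_pow_left₀ (sq_nonneg _) h2 2
          _ = ‖create h (ann h x)‖ ^ 2 * ‖x‖ ^ 2 := mul_pow _ _ _
          _ ≤ _ := mul_le_mul_of_nonneg_right hann (sq_nonneg _)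
      by_cases h0 : ‖ann h x‖ ^ 2 = 0
      · rw [h0]
        positivity
      · have hpos : 0 < ‖ann h x‖ ^ 2 := lt_of_le_of_ne (sq_nonneg _) (Ne.symm h0)
        nlinarith
    rw [norm_create_sq]
    have h4 : (q : ℝ) * ‖ann h x‖ ^ 2 ≤ |(q : ℝ)| * (bound q h * ‖x‖ ^ 2) :=
      mul_le_mul (le_abs_self _) h1 (sq_nonneg _) (abs_nonneg _)
    have h5 : ‖h‖ ^ 2 = bound q h * (1 - |(q : ℝ)|) := by
      rw [bound, div_mul_cancel₀ _ (one_sub_abs_pos q).ne']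
    rw [h5]
    linarith

theorem norm_create_le (h : E) (x : AlgFock q E) :
    ‖create h x‖ ≤ √(bound q h) * ‖x‖ := by
  obtain ⟨N, hN⟩ := exists_bound x
  refine le_of_sq_le_sq ?_ (by positivity)
  rw [mul_pow, Real.sq_sqrt (bound_nonneg h)]
  exact norm_create_sq_le h N x hN

theorem norm_createR_le (h : E) (x : AlgFock q E) :
    ‖createR h x‖ ≤ √(bound q h) * ‖x‖ := by
  rw [createR_eq, norm_flip, ← norm_flip x]
  exact norm_create_le h _

end AlgFock

end Fock

/-! ### The `q`-Fock space, its creation and annihilation operators, and the `q`-Gaussian algebras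

Throughout, `V` is a real Hilbert space and `-1 < q < 1`. -/

section Gaussian

variable (q : Set.Ioo (-1 : ℝ) 1)
variable {V : Type*} [NormedAddCommGroup V] [InnerProductSpace ℝ V]

/-- The `q`-deformed Fock space `𝓕_q(V)`: the Hilbert space completion of
`⨁ₙ (ℂ ⊗_ℝ V)^{⊗ n}` for the `q`-inner product. -/
abbrev Fock (V : Type*) [NormedAddCommGroup V] [InnerProductSpace ℝ V] : Type _ :=
  UniformSpace.Completion (AlgFock q (Complexification V))

variable {q}

/-- The inclusion of the algebraic tensor power `(ℂ ⊗_ℝ V)^{⊗ n}` into the `q`-Fock space. -/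
def Fock.of (n : ℕ) : (⨂[ℂ]^n (Complexification V)) →ₗ[ℂ] Fock q V :=
  (UniformSpace.Completion.toComplₗᵢ (𝕜 := ℂ)).toLinearMap.comp (AlgFock.of n)

/-- The word `w₁ ⊗ ⋯ ⊗ w_n` as an element of the `q`-Fock space. -/
def word {n : ℕ} (w : Fin n → Complexification V) : Fock q V :=
  Fock.of n (PiTensorProduct.tprod ℂ w)

/-- The `q`-inner product of two words of the same length. -/
theorem inner_word_word {n : ℕ} (v w : Fin n → Complexification V) :
    inner ℂ (word v : Fock q V) (word w) = ∑ σ : Equiv.Perm (Fin n),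
      (((q : ℝ) : ℂ)) ^ inversions σ * ∏ i, inner ℂ (v i) (w (σ i)) := by
  rw [← qForm_tprod, ← AlgFock.inner_of_of (q := q)]
  exact UniformSpace.Completion.inner_coe _ _

variable (q V) in
/-- The vacuum vector `Ω`. -/
def vacuum : Fock q V := word Fin.elim0

variable (q V) in
/-- The subspace `H^{⊗ k}` of the `q`-Fock space (`H` the complexification of `V`): the closure of
the algebraic tensor power. -/
def tensorPart (k : ℕ) : Submodule ℂ (Fock q V) :=
  (LinearMap.range (Fock.of (q := q) (V := V) k)).topologicalClosure

/-- The left creation operator `c(h)`. -/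
def creation (h : V) : Fock q V →L[ℂ] Fock q V :=
  ((AlgFock.create (q := q) (Complexification.ofReal h)).mkContinuous _
    (AlgFock.norm_create_le _)).completion

/-- The right creation operator `c_r(h)`. -/
def creationR (h : V) : Fock q V →L[ℂ] Fock q V :=
  ((AlgFock.createR (q := q) (Complexification.ofReal h)).mkContinuous _
    (AlgFock.norm_createR_le _)).completion

theorem creation_word (h : V) {n : ℕ} (w : Fin n → Complexification V) :
    creation h (word w : Fock q V)
      = word (Fin.cons (Complexification.ofReal h) w : Fin (n + 1) → Complexification V) := by
  rw [word, word, ← tensorCons_tprod]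
  refine (ContinuousLinearMap.completion_apply_coe _ _).trans ?_
  exact congrArg _ (AlgFock.graded_of _ n _)

theorem creationR_word (h : V) {n : ℕ} (w : Fin n → Complexification V) :
    creationR h (word w : Fock q V)
      = word (Fin.snoc w (Complexification.ofReal h) : Fin (n + 1) → Complexification V) := by
  rw [word, word, ← tensorSnoc_tprod]
  refine (ContinuousLinearMap.completion_apply_coe _ _).trans ?_
  exact congrArg _ (AlgFock.graded_of _ n _)

/-- The left annihilation operator `a(h) = c(h)^*`. -/
def annihilation (h : V) : Fock q V →L[ℂ] Fock q V := (creation h).adjoint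

/-- The right annihilation operator `a_r(h) = c_r(h)^*`. -/
def annihilationR (h : V) : Fock q V →L[ℂ] Fock q V := (creationR h).adjoint

/-- The field operator `s(h) = c(h) + a(h)`. -/
def field (h : V) : Fock q V →L[ℂ] Fock q V := creation h + annihilation h

/-- The von Neumann algebra `(S ∪ S^*)''` generated by a set `S` of bounded operators. -/
def generatedVN {H : Type*} [NormedAddCommGroup H] [InnerProductSpace ℂ H] [CompleteSpace H]
    (S : Set (H →L[ℂ] H)) : VonNeumannAlgebra H where
  toStarSubalgebra := StarSubalgebra.centralizer ℂ (StarSubalgebra.centralizer ℂ S : Set (H →L[ℂ] H))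
  centralizer_centralizer' := by
    change Set.centralizer (Set.centralizer
      (StarSubalgebra.centralizer ℂ (StarSubalgebra.centralizer ℂ S : Set (H →L[ℂ] H)) :
        Set (H →L[ℂ] H))) =
      (StarSubalgebra.centralizer ℂ (StarSubalgebra.centralizer ℂ S : Set (H →L[ℂ] H)) :
        Set (H →L[ℂ] H))
    rw [StarSubalgebra.coe_centralizer_centralizer, Set.centralizer_centralizer_centralizer]

variable (q V) in
/-- The `q`-Gaussian algebra `M = Γ_q(V)`, generated by `s(h)`, `h ∈ V`. -/
def gaussianAlgebra : VonNeumannAlgebra (Fock q V) :=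
  generatedVN (Set.range field)

variable (q) in
/-- The generator subalgebra `A = Γ_q(ℝe) ⊆ Γ_q(V)`, generated by `s(h)`, `h ∈ ℝe`. -/
def generatorSubalgebra (e : V) : VonNeumannAlgebra (Fock q V) :=
  generatedVN (field '' (Submodule.span ℝ {e} : Set V))

/-- The space `L²(N)` of a von Neumann algebra `N` on `𝓕_q(V)` with respect to the vacuum state,
realized in `𝓕_q(V)` as the closure of `{x Ω : x ∈ N}`. -/
def L2 (N : VonNeumannAlgebra (Fock q V)) : Submodule ℂ (Fock q V) :=
  (Submodule.span ℂ {ξ | ∃ x ∈ N, x (vacuum q V) = ξ}).topologicalClosure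

variable (q) in
/-- `T^k = {ξ ∈ H^{⊗ k} : a(e) ξ = a_r(e) ξ = 0}`. -/
def T (e : V) (k : ℕ) : Submodule ℂ (Fock q V) :=
  tensorPart q V k ⊓ (annihilation e).ker ⊓ (annihilationR e).ker

/-- `ξ_{r,s} = e^{⊗ r} ⊗ ξ ⊗ e^{⊗ s}`. -/
def sandwich (e : V) (ξ : Fock q V) (r s : ℕ) : Fock q V :=
  (creation e ^ r) ((creationR e ^ s) ξ)

end Gaussian

end QFock

end

namespace QFock

/-! ### Commutation relations on tensor powers -/

section Tensor

open PiTensorProduct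

variable {E : Type*} [NormedAddCommGroup E] [InnerProductSpace ℂ E] {n : ℕ}

/-! For small |q| the normalized vectors ξ_{r,s} are almost orthonormal: their Gram matrix differs
from the identity by a matrix of norm at most 1/2.

Write [n] = (1 - q^n)/(1 - q). For ξ in T^k the commutation relations a(e)c(e) = 1 + q c(e)a(e) and
a(e)c_r(e) = c_r(e)a(e) + q^n on H^{⊗n} give a(e)ξ_{r,s} = [r] ξ_{r-1,s} + q^{r+k} [s] ξ_{r,s-1}.
The flip of words gives the mirror formula for a_r(e). Peeling creation operators off one side of an
inner product therefore yields (`inner_sandwich`) (1-q)^{r+s} ⟨ξ_{r,s}, ξ'_{r',s'}⟩ = G ⟨ξ, ξ'⟩,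
with a scalar G (`gram`) that satisfies an explicit recursion and vanishes unless r + s = r' + s'.
Hence only vectors with the same basis element ξ and the same r + s can fail to be orthogonal.

Two estimates for G with k ≥ 1 and |q| ≤ 1/40 carry the proof. Off the diagonal |G| ≤ 4|q|^{|r-r'|}
(`abs_gram_le`): the second term of the recursion moves the pair of indices one step relative to the
diagonal, and its factor q^k pays for that step. On the diagonal G ≥ 1/2 (`half_le_gram_diag`): each
step of the recursion loses at most 5|q|^{n+1}, a summable amount. After normalization the
off-diagonal entries are at most 8|q|^{|r-r'|}, each row sums to at most 16/39 < 1/2, and the Schur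
test (`abs_norm_sq_sum_sub_le`) gives the constants 1/2 and 3/2.

For the closed span, L²(M) is the whole Fock space since Ω is cyclic (`L2_gaussianAlgebra`), and
L²(A) is spanned by the vectors e^{⊗n} (`L2_generatorSubalgebra`). A vector of H^{⊗(n+1)} orthogonal
to c(e)H^{⊗n} and c_r(e)H^{⊗n} is killed by a(e) and a_r(e), so it lies in T^{n+1}; by induction on
the degree the ξ_{r,s} and the e^{⊗n} together are total (`closure_span_sandwichSet`). The former
are orthogonal to the latter, so they span the complement of L²(A). -/

theorem tensorAnn_tensorSnoc_zero (q : ℝ) (h h' : E) (y : ⨂[ℂ]^0 E) :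
    tensorAnn q h (tensorSnoc h' y) = inner ℂ h h' • y := by
  induction y using PiTensorProduct.induction_on with
  | add y y' hy hy' => rw [map_add, map_add, hy, hy', smul_add]
  | smul_tprod r w =>
    rw [map_smul, map_smul, tensorSnoc_tprod, tensorAnn_tprod, smul_comm]
    congr 1
    rw [Fin.sum_univ_one, Fin.val_zero, pow_zero, one_smul]
    congr 2
    funext j
    exact j.elim0

/-- Removing one of the old letters commutes with appending h'. The extra term comes from removing
the appended letter itself, which sits at position n + 1 and so carries the weight q^{n+1}. -/
theorem tensorAnn_tensorSnoc (q : ℝ) (h h' : E) (y : ⨂[ℂ]^(n + 1) E) :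
    tensorAnn q h (tensorSnoc h' y)
      = tensorSnoc h' (tensorAnn q h y) + (q : ℂ) ^ (n + 1) • inner ℂ h h' • y := by
  induction y using PiTensorProduct.induction_on with
  | add y y' hy hy' =>
    simp only [map_add, hy, hy', smul_add]
    abel
  | smul_tprod r w =>
    change Fin (n + 1) → E at w
    simp only [map_smul]
    rw [smul_comm (inner ℂ h h') r, smul_comm ((q : ℂ) ^ (n + 1)) r, ← smul_add]
    congr 1
    rw [tensorSnoc_tprod, tensorAnn_tprod, Fin.sum_univ_castSucc, tensorAnn_tprod, map_sum]
    congr 1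
    · refine Finset.sum_congr rfl fun i _ => ?_
      have : (Fin.castSucc i).removeNth (Fin.snoc w h' : Fin (n + 2) → E)
          = (Fin.snoc (i.removeNth w) h' : Fin (n + 1) → E) := by
        funext j
        refine Fin.lastCases ?_ (fun j => ?_) j
        · have e : (i.castSucc).succAbove (Fin.last n) = Fin.last (n + 1) := by
            rw [Fin.succAbove_castSucc_of_le _ _ (Fin.le_last i), Fin.succ_last]
          rw [Fin.removeNth_apply, e, Fin.snoc_last, Fin.snoc_last]
        · rw [Fin.removeNth_apply, Fin.castSucc_succAbove_castSucc, Fin.snoc_castSucc,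
            Fin.snoc_castSucc, Fin.removeNth_apply]
      rw [this]
      simp only [map_smul, tensorSnoc_tprod, Fin.val_castSucc, Fin.snoc_castSucc]
    · rw [Fin.val_last, Fin.snoc_last]
      congr 3
      funext j
      rw [Fin.removeNth_apply, Fin.succAbove_last, Fin.snoc_castSucc]

theorem tensorCons_tensorSnoc (h h' : E) (y : ⨂[ℂ]^n E) :
    tensorCons h (tensorSnoc h' y) = tensorSnoc h' (tensorCons h y) := by
  induction y using PiTensorProduct.induction_on with
  | add y y' hy hy' => simp only [map_add, hy, hy']
  | smul_tprod r w =>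
    simp only [map_smul]
    rw [tensorSnoc_tprod, tensorCons_tprod, tensorCons_tprod, tensorSnoc_tprod,
      Fin.cons_snoc_eq_snoc_cons]

theorem tensorFlip_tensorFlip (y : ⨂[ℂ]^n E) : tensorFlip (tensorFlip y) = y := by
  induction y using PiTensorProduct.induction_on with
  | add y y' hy hy' => simp only [map_add, hy, hy']
  | smul_tprod r w =>
    simp only [map_smul, tensorFlip_tprod]
    congr 3
    funext i
    rw [Fin.rev_rev]

end Tensor

/-! ### The same relations on the algebraic Fock space -/

namespace AlgFock

variable {E : Type*} [NormedAddCommGroup E] [InnerProductSpace ℂ E] {q : Set.Ioo (-1 : ℝ) 1}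

theorem flip_flip (x : AlgFock q E) : flip (flip x) = x := by
  refine induction_on x (by simp) (fun n s => ?_) fun x x' hx hx' => by
    simp only [map_add, hx, hx']
  rw [flip, graded_of, graded_of, tensorFlip_tensorFlip]

theorem create_createR (h h' : E) (x : AlgFock q E) :
    create h (createR h' x) = createR h' (create h x) := by
  refine induction_on x (by simp) (fun n s => ?_) fun x x' hx hx' => by
    simp only [map_add, hx, hx']
  rw [createR, create, graded_of, graded_of, graded_of, graded_of, tensorCons_tensorSnoc]

theorem ann_createR_of (h h' : E) (n : ℕ) (t : ⨂[ℂ]^n E) :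
    ann h (createR h' (of n t : AlgFock q E))
      = createR h' (ann h (of n t)) + ((q : ℝ) : ℂ) ^ n • inner ℂ h h' • of n t := by
  rw [createR, graded_of, ann_of_succ]
  rcases n with _ | n
  · rw [ann_of_zero, map_zero, tensorAnn_tensorSnoc_zero, map_smul]
    simp
  · rw [ann_of_succ, graded_of, tensorAnn_tensorSnoc, map_add, map_smul, map_smul]

end AlgFock

/-! ### Relations between the operators on the `q`-Fock space -/

section Operators

open UniformSpace.Completion

variable {q : Set.Ioo (-1 : ℝ) 1} {V : Type*} [NormedAddCommGroup V] [InnerProductSpace ℝ V]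

theorem creation_coe (h : V) (x : AlgFock q (Complexification V)) :
    creation h (x : Fock q V)
      = (AlgFock.create (Complexification.ofReal h) x : AlgFock q (Complexification V)) :=
  ContinuousLinearMap.completion_apply_coe _ _

theorem creationR_coe (h : V) (x : AlgFock q (Complexification V)) :
    creationR h (x : Fock q V)
      = (AlgFock.createR (Complexification.ofReal h) x : AlgFock q (Complexification V)) :=
  ContinuousLinearMap.completion_apply_coe _ _

theorem inner_creation (h : V) (x y : Fock q V) :
    inner ℂ (creation h x) y = inner ℂ x (annihilation h y) :=
  (ContinuousLinearMap.adjoint_inner_right _ _ _).symm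

theorem inner_creationR (h : V) (x y : Fock q V) :
    inner ℂ (creationR h x) y = inner ℂ x (annihilationR h y) :=
  (ContinuousLinearMap.adjoint_inner_right _ _ _).symm

/-- Identifies the Hilbert space adjoint with the explicit sum over removed letters, so that
identities on algebraic tensors extend by continuity. -/
theorem annihilation_coe (h : V) (y : AlgFock q (Complexification V)) :
    annihilation h (y : Fock q V)
      = (AlgFock.ann (Complexification.ofReal h) y : AlgFock q (Complexification V)) := by
  refine ext_inner_left ℂ fun x => ?_
  rw [← inner_creation]
  induction x using UniformSpace.Completion.induction_on with
  | hp => exact isClosed_eq (by fun_prop) (by fun_prop)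
  | ih x => rw [creation_coe, inner_coe, inner_coe, AlgFock.inner_create]

/-- The flip `w₁ ⊗ ⋯ ⊗ w_n ↦ w_n ⊗ ⋯ ⊗ w₁` on the `q`-Fock space. -/
noncomputable def flipOp : Fock q V →L[ℂ] Fock q V :=
  ((AlgFock.flip (q := q) (E := Complexification V)).mkContinuous 1
    fun x => by rw [AlgFock.norm_flip, one_mul]).completion

theorem flipOp_coe (x : AlgFock q (Complexification V)) :
    flipOp (x : Fock q V) = (AlgFock.flip x : AlgFock q (Complexification V)) :=
  ContinuousLinearMap.completion_apply_coe _ _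

theorem flipOp_flipOp (x : Fock q V) : flipOp (flipOp x) = x := by
  induction x using UniformSpace.Completion.induction_on with
  | hp => exact isClosed_eq (by fun_prop) (by fun_prop)
  | ih x => rw [flipOp_coe, flipOp_coe, AlgFock.flip_flip]

theorem inner_flipOp (x y : Fock q V) : inner ℂ (flipOp x) y = inner ℂ x (flipOp y) := by
  induction x using UniformSpace.Completion.induction_on with
  | hp => exact isClosed_eq (by fun_prop) (by fun_prop)
  | ih x =>
    induction y using UniformSpace.Completion.induction_on with
    | hp => exact isClosed_eq (by fun_prop) (by fun_prop)
    | ih y =>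
      rw [flipOp_coe, flipOp_coe, inner_coe, inner_coe, ← AlgFock.inner_flip, AlgFock.flip_flip]

theorem creationR_eq_flipOp (h : V) (x : Fock q V) :
    creationR h x = flipOp (creation h (flipOp x)) := by
  induction x using UniformSpace.Completion.induction_on with
  | hp => exact isClosed_eq (by fun_prop) (by fun_prop)
  | ih x => rw [creationR_coe, flipOp_coe, creation_coe, flipOp_coe, AlgFock.createR_eq]

/-- The flip is a self-adjoint involution conjugating c(h) to c_r(h), hence also their adjoints.
Facts about right operators are deduced from the left ones in this way. -/
theorem annihilationR_eq_flipOp (h : V) (x : Fock q V) :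
    annihilationR h x = flipOp (annihilation h (flipOp x)) := by
  refine ext_inner_left ℂ fun y => ?_
  rw [← inner_creationR, creationR_eq_flipOp, inner_flipOp, inner_creation, inner_flipOp]

theorem creation_creationR (h h' : V) (x : Fock q V) :
    creation h (creationR h' x) = creationR h' (creation h x) := by
  induction x using UniformSpace.Completion.induction_on with
  | hp => exact isClosed_eq (by fun_prop) (by fun_prop)
  | ih x => rw [creationR_coe, creation_coe, creation_coe, creationR_coe, AlgFock.create_createR]

theorem annihilation_creation {e : V} (he : ‖e‖ = 1) (x : Fock q V) :
    annihilation e (creation e x) = x + ((q : ℝ) : ℂ) • creation e (annihilation e x) := by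
  induction x using UniformSpace.Completion.induction_on with
  | hp =>
    exact isClosed_eq ((annihilation e).continuous.comp (creation e).continuous)
      (continuous_id.add (((q : ℝ) : ℂ) • (creation e).comp (annihilation e)).continuous)
  | ih x =>
    rw [creation_coe, annihilation_coe, annihilation_coe, creation_coe, AlgFock.ann_create,
      Complexification.inner_ofReal, real_inner_self_eq_norm_sq, he, coe_add, coe_smul, coe_smul,
      one_pow, Complex.ofReal_one, one_smul]

/-! ### The grading -/

theorem coe_of_mem_tensorPart (n : ℕ) (t : ⨂[ℂ]^n (Complexification V)) :
    ((AlgFock.of n t : AlgFock q (Complexification V)) : Fock q V) ∈ tensorPart q V n :=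
  Submodule.le_topologicalClosure _ ⟨t, rfl⟩

theorem tensorPart_le {n : ℕ} {S : Submodule ℂ (Fock q V)} (hS : IsClosed (S : Set (Fock q V)))
    (h : ∀ t : ⨂[ℂ]^n (Complexification V),
      ((AlgFock.of n t : AlgFock q (Complexification V)) : Fock q V) ∈ S) :
    tensorPart q V n ≤ S :=
  Submodule.topologicalClosure_minimal _ (by rintro _ ⟨t, rfl⟩; exact h t) hS

theorem isClosed_tensorPart (n : ℕ) : IsClosed (tensorPart q V n : Set (Fock q V)) :=
  Submodule.isClosed_topologicalClosure _

theorem isClosed_comap {H : Type*} [NormedAddCommGroup H] [InnerProductSpace ℂ H]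
    {S : Submodule ℂ H} (hS : IsClosed (S : Set H)) (f : H →L[ℂ] H) :
    IsClosed (S.comap (f : H →ₗ[ℂ] H) : Set H) :=
  hS.preimage f.continuous

theorem creation_mem_tensorPart (h : V) {n : ℕ} {x : Fock q V} (hx : x ∈ tensorPart q V n) :
    creation h x ∈ tensorPart q V (n + 1) := by
  refine tensorPart_le (isClosed_comap (isClosed_tensorPart (n + 1)) (creation h))
    (fun t => ?_) hx
  change creation h _ ∈ tensorPart q V (n + 1)
  rw [creation_coe, AlgFock.create, AlgFock.graded_of]
  exact coe_of_mem_tensorPart _ _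

theorem flipOp_mem_tensorPart {n : ℕ} {x : Fock q V} (hx : x ∈ tensorPart q V n) :
    flipOp x ∈ tensorPart q V n := by
  refine tensorPart_le (isClosed_comap (isClosed_tensorPart n) flipOp) (fun t => ?_) hx
  change flipOp _ ∈ tensorPart q V n
  rw [flipOp_coe, AlgFock.flip, AlgFock.graded_of]
  exact coe_of_mem_tensorPart _ _

theorem creationR_mem_tensorPart (h : V) {n : ℕ} {x : Fock q V} (hx : x ∈ tensorPart q V n) :
    creationR h x ∈ tensorPart q V (n + 1) := by
  rw [creationR_eq_flipOp]
  exact flipOp_mem_tensorPart (creation_mem_tensorPart h (flipOp_mem_tensorPart hx))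

theorem annihilation_mem_tensorPart (h : V) {n : ℕ} {x : Fock q V}
    (hx : x ∈ tensorPart q V (n + 1)) : annihilation h x ∈ tensorPart q V n := by
  refine tensorPart_le (isClosed_comap (isClosed_tensorPart n) (annihilation h)) (fun t => ?_) hx
  change annihilation h _ ∈ tensorPart q V n
  rw [annihilation_coe, AlgFock.ann_of_succ]
  exact coe_of_mem_tensorPart _ _

theorem annihilationR_mem_tensorPart (h : V) {n : ℕ} {x : Fock q V}
    (hx : x ∈ tensorPart q V (n + 1)) : annihilationR h x ∈ tensorPart q V n := by
  rw [annihilationR_eq_flipOp]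
  exact flipOp_mem_tensorPart (annihilation_mem_tensorPart h (flipOp_mem_tensorPart hx))

theorem annihilation_eq_zero (h : V) {x : Fock q V} (hx : x ∈ tensorPart q V 0) :
    annihilation h x = 0 := by
  refine tensorPart_le (S := (annihilation h).ker) (annihilation h).isClosed_ker (fun t => ?_) hx
  change annihilation h _ = 0
  rw [annihilation_coe, AlgFock.ann_of_zero]
  rfl

theorem inner_eq_zero_of_mem_tensorPart {n m : ℕ} (hnm : n ≠ m) {x y : Fock q V}
    (hx : x ∈ tensorPart q V n) (hy : y ∈ tensorPart q V m) : inner ℂ x y = 0 := by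
  have h1 : tensorPart q V m ≤ (tensorPart q V n)ᗮ := by
    refine tensorPart_le (Submodule.isClosed_orthogonal _) fun t => ?_
    rw [Submodule.mem_orthogonal']
    intro u hu
    -- Both spaces are closures, so density is used twice: here for the first variable with an
    -- algebraic tensor `t` fixed, and in `h1` for the second.
    have h2 : tensorPart q V n ≤
        (ℂ ∙ ((AlgFock.of m t : AlgFock q (Complexification V)) : Fock q V))ᗮ := by
      refine tensorPart_le (Submodule.isClosed_orthogonal _) fun s => ?_
      rw [Submodule.mem_orthogonal_singleton_iff_inner_right, inner_coe,
        AlgFock.inner_of_of_ne hnm.symm]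
    exact (Submodule.mem_orthogonal_singleton_iff_inner_right).1 (h2 hu)
  exact (Submodule.mem_orthogonal _ _).1 (h1 hy) x hx

/-- The correction term depends on the degree, so the relation is stated on one H^{⊗n} at a time: it
says that H^{⊗n} lies in the kernel of a bounded operator, which can be checked on algebraic
tensors. -/
theorem annihilation_creationR {e : V} (he : ‖e‖ = 1) {n : ℕ} {x : Fock q V}
    (hx : x ∈ tensorPart q V n) :
    annihilation e (creationR e x)
      = creationR e (annihilation e x) + ((q : ℝ) : ℂ) ^ n • x := by
  have : tensorPart q V n ≤ ((annihilation e).comp (creationR e)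
      - (creationR e).comp (annihilation e)
      - ((q : ℝ) : ℂ) ^ n • ContinuousLinearMap.id ℂ (Fock q V)).ker := by
    refine tensorPart_le (ContinuousLinearMap.isClosed_ker _) fun t => ?_
    simp only [LinearMap.mem_ker, ContinuousLinearMap.coe_coe, sub_sub, sub_apply,
      add_apply, smul_apply,
      ContinuousLinearMap.comp_apply, ContinuousLinearMap.id_apply]
    rw [creationR_coe, annihilation_coe, annihilation_coe, creationR_coe, AlgFock.ann_createR_of,
      Complexification.inner_ofReal, real_inner_self_eq_norm_sq, he, coe_add, coe_smul, coe_smul,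
      one_pow, Complex.ofReal_one, one_smul, sub_self]
  have h := this hx
  simp only [LinearMap.mem_ker, ContinuousLinearMap.coe_coe, sub_apply,
    ContinuousLinearMap.comp_apply, sub_sub, sub_eq_zero] at h
  exact h

theorem eq_top_of_tensorPart_le {S : Submodule ℂ (Fock q V)}
    (hS : IsClosed (S : Set (Fock q V))) (h : ∀ n, tensorPart q V n ≤ S) : S = ⊤ := by
  refine (Submodule.eq_top_iff').2 fun x => ?_
  induction x using UniformSpace.Completion.induction_on with
  | hp => exact hS
  | ih x =>
    refine AlgFock.induction_on x ?_ (fun n t => h n (coe_of_mem_tensorPart n t))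
      fun x y hx hy => ?_
    · exact S.zero_mem
    · rw [coe_add]
      exact S.add_mem hx hy

end Operators

/-! ### The rescaled Gram matrix of the vectors `ξ_{r,s}` -/

/-- The inner product of `ξ_{r,s}` and `ξ_{r',s'}` for a unit vector `ξ` of degree `k` annihilated
by `a(e)` and `a_r(e)`, multiplied by `(1 - q) ^ (r + s)`. -/
noncomputable def gram (q : ℝ) (k : ℕ) : ℕ → ℕ → ℕ → ℕ → ℝ
  | 0, 0, r', s' => if r' = 0 ∧ s' = 0 then 1 else 0
  -- The recursion lowers s by a_r(e) when r = 0, and otherwise lowers r by a(e). Truncated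
  -- subtraction is harmless: an index 0 that would be lowered comes with the coefficient 1 - q^0 =
  -- 0.
  | 0, s + 1, r', s' => (1 - q ^ s') * gram q k 0 s r' (s' - 1)
      + q ^ (s' + k) * (1 - q ^ r') * gram q k 0 s (r' - 1) s'
  | r + 1, s, r', s' => (1 - q ^ r') * gram q k r s (r' - 1) s'
      + q ^ (r' + k) * (1 - q ^ s') * gram q k r s r' (s' - 1)
termination_by r s => r + s

theorem gram_eq_zero (q : ℝ) (k : ℕ) (r s r' s' : ℕ) (h : r + s ≠ r' + s') :
    gram q k r s r' s' = 0 := by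
  induction r generalizing r' s' with
  | zero =>
    induction s generalizing r' s' with
    | zero =>
      rw [gram, if_neg (by omega)]
    | succ s ih =>
      rw [gram]
      rcases r' with _ | r' <;> rcases s' with _ | s'
      · simp
      · rw [pow_zero, sub_self, mul_zero, zero_mul, add_zero, ih _ _ (by omega), mul_zero]
      · rw [pow_zero, sub_self, zero_mul, zero_add, ih _ _ (by omega), mul_zero]
      · rw [ih _ _ (by omega), ih _ _ (by omega), mul_zero, mul_zero, add_zero]
  | succ r ih =>
    rw [gram]
    rcases r' with _ | r' <;> rcases s' with _ | s'
    · simp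
    · rw [pow_zero, sub_self, zero_mul, zero_add, ih _ _ (by omega), mul_zero]
    · rw [pow_zero, sub_self, mul_zero, zero_mul, add_zero, ih _ _ (by omega), mul_zero]
    · rw [ih _ _ (by omega), ih _ _ (by omega), mul_zero, mul_zero, add_zero]

/-- The weights controlling the growth of the entries of the Gram matrix. -/
noncomputable def gramWeight (p : ℝ) (n : ℕ) : ℝ := (1 - 6 * p + 6 * p * p ^ n)⁻¹

/-! ### Weights for the induction on the Gram entries -/

section Weight

variable {p : ℝ} (h0 : 0 ≤ p) (h1 : p ≤ 1 / 40)
include h0 h1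

theorem gramWeight_inv_pos (n : ℕ) : 1 / 2 ≤ 1 - 6 * p + 6 * p * p ^ n := by
  have : 0 ≤ 6 * p * p ^ n := by positivity
  linarith

theorem gramWeight_nonneg (n : ℕ) : 0 ≤ gramWeight p n :=
  inv_nonneg.2 (le_trans (by norm_num) (gramWeight_inv_pos h0 h1 n))

theorem gramWeight_le_two (n : ℕ) : gramWeight p n ≤ 2 := by
  have := inv_anti₀ (by norm_num) (gramWeight_inv_pos h0 h1 n)
  simpa [gramWeight] using this

/-- This inequality dictates the weights: one step of the recursion multiplies the bound by about (1
+ p^{n+1})/(1 - 2p^{n+1}). The reciprocal weights decrease by 6p^{n+1}(1 - p), which exceeds the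
3p^{n+1} that is needed, while they never fall below 1 - 6p, so the weights stay bounded. -/
theorem gramWeight_step (n : ℕ) :
    (1 + p ^ (n + 1)) * gramWeight p n + 2 * p ^ (n + 1) * gramWeight p (n + 1)
      ≤ gramWeight p (n + 1) := by
  have ha := gramWeight_inv_pos h0 h1 n
  have hb := gramWeight_inv_pos h0 h1 (n + 1)
  have hx0 : 0 ≤ p ^ n := by positivity
  have hx1 : p ^ n ≤ 1 := pow_le_one₀ h0 (by linarith)
  suffices h : (1 + p ^ (n + 1)) * gramWeight p n ≤ (1 - 2 * p ^ (n + 1)) * gramWeight p (n + 1) by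
    linarith
  unfold gramWeight
  rw [← div_eq_mul_inv, ← div_eq_mul_inv, div_le_div_iff₀ (by linarith) (by linarith)]
  rw [pow_succ] at *
  -- The cleared inequality is (1 + px)(1 - 6p + 6p·px) ≤ (1 - 2px)(1 - 6p + 6px). To first order in
  -- px the right side wins; the facts below control the higher order products.
  set x := p ^ n
  have hpx : 0 ≤ p * x := by positivity
  have e1 : 0 ≤ p * x * p := by positivity
  have e2 : 0 ≤ p * x * (1 - x) := mul_nonneg hpx (by linarith)
  have e3 : p * x * p ≤ p * x * (1 / 40) := mul_le_mul_of_nonneg_left h1 hpx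
  have e4 : p * x * p * x ≤ p * x * p := by nlinarith
  have e5 : 0 ≤ p * x * p * x := by positivity
  have e6 : 0 ≤ p * x * p * x * p := by positivity
  nlinarith

theorem gramWeight_step_le (n : ℕ) :
    (1 + p ^ (n + 1)) * gramWeight p n ≤ gramWeight p (n + 1) := by
  have := gramWeight_step h0 h1 n
  have : 0 ≤ 2 * p ^ (n + 1) * gramWeight p (n + 1) :=
    mul_nonneg (by positivity) (gramWeight_nonneg h0 h1 _)
  linarith

theorem gramWeight_le_succ (n : ℕ) : gramWeight p n ≤ gramWeight p (n + 1) := by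
  have := gramWeight_step_le h0 h1 n
  have : 0 ≤ p ^ (n + 1) * gramWeight p n :=
    mul_nonneg (by positivity) (gramWeight_nonneg h0 h1 _)
  linarith

end Weight

theorem abs_one_sub_pow_le (q : ℝ) (n : ℕ) : |1 - q ^ n| ≤ 1 + |q| ^ n := by
  refine (abs_sub _ _).trans ?_
  rw [abs_one, abs_pow]

/-! ### Off-diagonal decay and lower bound on the diagonal -/

section Bounds

variable {q : ℝ} (hq : |q| ≤ 1 / 40)
include hq

theorem abs_one_sub_pow_le_two (n : ℕ) : |1 - q ^ n| ≤ 2 := by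
  have := abs_one_sub_pow_le q n
  have : |q| ^ n ≤ 1 := pow_le_one₀ (abs_nonneg q) (by linarith)
  linarith

/-- The common induction step of the estimate for the Gram matrix: the first variable is lowered
from `t + 1` to `t`, the second one from `u + 1` to `u`. -/
theorem abs_gram_step {k t u d d' : ℕ} {X Y : ℝ} (hd : d ≤ k + d')
    (hX : |X| ≤ gramWeight |q| t * gramWeight |q| (u + 1) * |q| ^ d)
    (hY : |Y| ≤ gramWeight |q| (t + 1) * gramWeight |q| u * |q| ^ d') :
    |(1 - q ^ (t + 1)) * X + q ^ (t + 1 + k) * (1 - q ^ (u + 1)) * Y|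
      ≤ gramWeight |q| (t + 1) * gramWeight |q| (u + 1) * |q| ^ d := by
  have h0 := abs_nonneg q
  have h1 : |(1 - q ^ (t + 1)) * X|
      ≤ (1 + |q| ^ (t + 1)) * (gramWeight |q| t * gramWeight |q| (u + 1) * |q| ^ d) := by
    rw [abs_mul]
    exact mul_le_mul (abs_one_sub_pow_le q _) hX (abs_nonneg _) (by positivity)
  -- The entry `Y` may be closer to the diagonal by up to k; the factor |q|^k makes up for it and
  -- leaves |q|^{t+1} for the weights.
  have hpow : |q| ^ k * |q| ^ d' ≤ |q| ^ d := by
    rw [← pow_add]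
    exact pow_le_pow_of_le_one h0 (by linarith) hd
  have h2 : |q ^ (t + 1 + k) * (1 - q ^ (u + 1)) * Y|
      ≤ 2 * |q| ^ (t + 1) * (gramWeight |q| (t + 1) * gramWeight |q| (u + 1) * |q| ^ d) := by
    have hw : gramWeight |q| (t + 1) * gramWeight |q| u
        ≤ gramWeight |q| (t + 1) * gramWeight |q| (u + 1) :=
      mul_le_mul_of_nonneg_left (gramWeight_le_succ h0 hq u) (gramWeight_nonneg h0 hq _)
    have hw0 : 0 ≤ gramWeight |q| (t + 1) * gramWeight |q| (u + 1) :=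
      mul_nonneg (gramWeight_nonneg h0 hq _) (gramWeight_nonneg h0 hq _)
    rw [abs_mul, abs_mul, abs_pow, pow_add]
    calc |q| ^ (t + 1) * |q| ^ k * |1 - q ^ (u + 1)| * |Y|
        ≤ |q| ^ (t + 1) * |q| ^ k * 2
          * (gramWeight |q| (t + 1) * gramWeight |q| (u + 1) * |q| ^ d') := by
          gcongr
          · exact abs_one_sub_pow_le_two hq _
          · exact hY.trans (mul_le_mul_of_nonneg_right hw (by positivity))
      _ = 2 * |q| ^ (t + 1) * (gramWeight |q| (t + 1) * gramWeight |q| (u + 1)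
          * (|q| ^ k * |q| ^ d')) := by ring
      _ ≤ _ := by gcongr
  have hc : 0 ≤ gramWeight |q| (u + 1) * |q| ^ d :=
    mul_nonneg (gramWeight_nonneg h0 hq _) (by positivity)
  have h3 := mul_le_mul_of_nonneg_right (gramWeight_step h0 hq t) hc
  refine (abs_add_le _ _).trans ((add_le_add h1 h2).trans ?_)
  linarith

/-- The variant of `abs_gram_step` in which only the first variable can be lowered. -/
theorem abs_gram_step_left {t d : ℕ} {X c : ℝ} (hc : 0 ≤ c)
    (hX : |X| ≤ gramWeight |q| t * c * |q| ^ d) :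
    |(1 - q ^ (t + 1)) * X| ≤ gramWeight |q| (t + 1) * c * |q| ^ d := by
  have h0 := abs_nonneg q
  rw [abs_mul]
  refine (mul_le_mul (abs_one_sub_pow_le q _) hX (abs_nonneg _) (by positivity)).trans ?_
  have := mul_le_mul_of_nonneg_right (gramWeight_step_le h0 hq t)
    (mul_nonneg hc (by positivity : 0 ≤ |q| ^ d))
  linarith

/-- The variant of `abs_gram_step` in which only the second variable can be lowered. -/
theorem abs_gram_step_right {k u d d' : ℕ} {Y c : ℝ} (hc : 0 ≤ c) (hd : d ≤ k + d')
    (hY : |Y| ≤ c * gramWeight |q| u * |q| ^ d') :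
    |q ^ k * (1 - q ^ (u + 1)) * Y| ≤ c * gramWeight |q| (u + 1) * |q| ^ d := by
  have h0 := abs_nonneg q
  have hpow : |q| ^ k * |q| ^ d' ≤ |q| ^ d := by
    rw [← pow_add]
    exact pow_le_pow_of_le_one h0 (by linarith) hd
  have := abs_gram_step_left hq (t := u) (d := d') (X := Y) (c := c) hc (by linarith)
  rw [mul_assoc, abs_mul, abs_pow]
  calc |q| ^ k * |(1 - q ^ (u + 1)) * Y|
      ≤ |q| ^ k * (gramWeight |q| (u + 1) * c * |q| ^ d') := by gcongr
    _ = c * gramWeight |q| (u + 1) * (|q| ^ k * |q| ^ d') := by ring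
    _ ≤ _ := by
      have := gramWeight_nonneg h0 hq (u + 1)
      gcongr

/-- The weights depend on the primed indices only, since each term of the recursion lowers exactly
one of these and has a coefficient controlled by it. Lowering r and r' together preserves the
distance, and the other term changes it by at most one, which needs k ≥ 1. -/
theorem abs_gram_le_weight {k : ℕ} (hk : 1 ≤ k) (r s r' s' : ℕ) (h : r + s = r' + s') :
    |gram q k r s r' s'| ≤ gramWeight |q| r' * gramWeight |q| s' * |q| ^ (Nat.dist r r') := by
  have hw := gramWeight_nonneg (abs_nonneg q) hq
  induction r generalizing r' s' with
  | zero =>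
    induction s generalizing r' s' with
    | zero =>
      obtain ⟨rfl, rfl⟩ : r' = 0 ∧ s' = 0 := by omega
      simp [gram, gramWeight]
    | succ s ih =>
      rw [gram]
      rcases s' with _ | t <;> rcases r' with _ | u
      · omega
      · rw [pow_zero, sub_self, zero_mul, zero_add, zero_add, add_tsub_cancel_right,
          mul_comm (gramWeight |q| (u + 1))]
        refine abs_gram_step_right hq (hw _) (d' := Nat.dist 0 u) ?_ ?_
        · simp only [Nat.dist]; omega
        · rw [mul_comm (gramWeight |q| 0)]
          exact ih _ _ (by omega)
      · rw [pow_zero, sub_self, mul_zero, zero_mul, add_zero, add_tsub_cancel_right,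
          mul_comm (gramWeight |q| 0)]
        refine abs_gram_step_left hq (hw _) ?_
        rw [mul_comm (gramWeight |q| t)]
        exact ih _ _ (by omega)
      · rw [add_tsub_cancel_right, add_tsub_cancel_right, mul_comm (gramWeight |q| (u + 1))]
        refine abs_gram_step hq (d' := Nat.dist 0 u) ?_ ?_ ?_
        · simp only [Nat.dist]; omega
        · rw [mul_comm (gramWeight |q| t)]
          exact ih _ _ (by omega)
        · rw [mul_comm (gramWeight |q| (t + 1))]
          exact ih _ _ (by omega)
  | succ r ih =>
    rw [gram]
    rcases r' with _ | t <;> rcases s' with _ | u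
    · omega
    · rw [pow_zero, sub_self, zero_mul, zero_add, zero_add, add_tsub_cancel_right]
      refine abs_gram_step_right hq (hw _) (d' := Nat.dist r 0) ?_ (ih _ _ (by omega))
      simp only [Nat.dist]; omega
    · rw [pow_zero, sub_self, mul_zero, zero_mul, add_zero, add_tsub_cancel_right,
        Nat.dist_succ_succ]
      exact abs_gram_step_left hq (hw _) (ih _ _ (by omega))
    · rw [add_tsub_cancel_right, add_tsub_cancel_right, Nat.dist_succ_succ]
      refine abs_gram_step hq (d' := Nat.dist r (t + 1)) ?_ (ih _ _ (by omega))
        (ih _ _ (by omega))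
      simp only [Nat.dist]; omega

/-- The entries of the Gram matrix decay exponentially away from the diagonal. -/
theorem abs_gram_le {k : ℕ} (hk : 1 ≤ k) (r s r' s' : ℕ) (h : r + s = r' + s') :
    |gram q k r s r' s'| ≤ 4 * |q| ^ (Nat.dist r r') := by
  refine (abs_gram_le_weight hq hk r s r' s' h).trans ?_
  have h0 := abs_nonneg q
  have := mul_le_mul (gramWeight_le_two h0 hq r') (gramWeight_le_two h0 hq s')
    (gramWeight_nonneg h0 hq _) (by norm_num)
  gcongr
  linarith

/-- Of the loss 5|q|^{r+1}, four parts come from the factor 1 - q^{r+1} on a diagonal entry of size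
at most 4. The remaining one covers the off-diagonal term, which is at most 8|q|·|q|^{r+1} because
its entry is at distance one. -/
theorem gram_diag_step {k : ℕ} (hk : 1 ≤ k) (r s : ℕ) :
    gram q k r s r s - 5 * |q| ^ (r + 1) ≤ gram q k (r + 1) s (r + 1) s := by
  have h0 := abs_nonneg q
  have h1 : |q ^ (r + 1) * gram q k r s r s| ≤ |q| ^ (r + 1) * 4 := by
    rw [abs_mul, abs_pow]
    have := abs_gram_le hq hk r s r s rfl
    rw [Nat.dist_self, pow_zero, mul_one] at this
    gcongr
  have h2 : |q ^ (r + 1 + k) * (1 - q ^ s) * gram q k r s (r + 1) (s - 1)| ≤ |q| ^ (r + 1) := by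
    rcases s with _ | s
    · simp
    · have hg := abs_gram_le hq hk r (s + 1) (r + 1) s (by omega)
      rw [show Nat.dist r (r + 1) = 1 by simp [Nat.dist], pow_one] at hg
      have hk' : |q| ^ k ≤ 1 := pow_le_one₀ h0 (by linarith)
      rw [abs_mul, abs_mul, abs_pow, pow_add, add_tsub_cancel_right]
      calc |q| ^ (r + 1) * |q| ^ k * |1 - q ^ (s + 1)| * |gram q k r (s + 1) (r + 1) s|
          ≤ |q| ^ (r + 1) * 1 * 2 * (4 * |q|) := by
            gcongr
            exact abs_one_sub_pow_le_two hq _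
        _ = |q| ^ (r + 1) * (8 * |q|) := by ring
        _ ≤ |q| ^ (r + 1) * 1 := by gcongr; linarith
        _ = _ := mul_one _
  rw [show gram q k (r + 1) s (r + 1) s = (1 - q ^ (r + 1)) * gram q k r s r s
      + q ^ (r + 1 + k) * (1 - q ^ s) * gram q k r s (r + 1) (s - 1) by
    rw [gram, add_tsub_cancel_right]]
  have h3 := le_abs_self (q ^ (r + 1) * gram q k r s r s)
  have h4 := neg_abs_le (q ^ (r + 1 + k) * (1 - q ^ s) * gram q k r s (r + 1) (s - 1))
  linarith

/-- The diagonal entries of the Gram matrix are bounded below. -/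
theorem half_le_gram_diag {k : ℕ} (hk : 1 ≤ k) (r s : ℕ) : 1 / 2 ≤ gram q k r s r s := by
  have h0 := abs_nonneg q
  -- Puts the loss in telescoping form, using 2(1 - |q|) ≥ 1. The total loss in both directions is
  -- then at most 20|q| ≤ 1/2, and this is where the bound 1/40 is sharp for the argument.
  have hstep : ∀ n : ℕ, 5 * |q| ^ (n + 1) ≤ 10 * |q| * (|q| ^ n - |q| ^ (n + 1)) := by
    intro n
    have : 0 ≤ |q| * |q| ^ n := by positivity
    rw [pow_succ']
    nlinarith
  have key : 1 - 10 * |q| * (2 - |q| ^ r - |q| ^ s) ≤ gram q k r s r s := by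
    induction r with
    | zero =>
      induction s with
      | zero => norm_num [gram]
      | succ s ih =>
        -- On the edge r = r' = 0 the off-diagonal term has coefficient zero.
        rw [gram, pow_zero, pow_zero, sub_self, mul_zero, zero_mul, add_zero, add_tsub_cancel_right]
        have h1 : |q ^ (s + 1) * gram q k 0 s 0 s| ≤ |q| ^ (s + 1) * 4 := by
          rw [abs_mul, abs_pow]
          have := abs_gram_le hq hk 0 s 0 s rfl
          rw [Nat.dist_self, pow_zero, mul_one] at this
          gcongr
        have h3 := le_abs_self (q ^ (s + 1) * gram q k 0 s 0 s)
        have h4 : 0 ≤ |q| ^ (s + 1) := by positivity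
        have := hstep s
        rw [pow_zero] at ih
        linarith
    | succ r ih =>
      have := gram_diag_step hq hk r s
      have := hstep r
      linarith
  have h1 : 0 ≤ |q| * |q| ^ r := by positivity
  have h2 : 0 ≤ |q| * |q| ^ s := by positivity
  linarith

end Bounds

/-! ### Almost orthogonal families -/

section AlmostOrthogonal

variable {P H : Type*} [NormedAddCommGroup H] [InnerProductSpace ℂ H]

/-- The Schur test: a finite family whose Gram matrix is close to a diagonal matrix is almost
orthogonal. -/
theorem abs_norm_sq_sum_sub_le {κ : P → P → ℝ} (hκ0 : ∀ p p', 0 ≤ κ p p')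
    (hκs : ∀ p p', κ p p' = κ p' p)
    (hκ : ∀ (s : Finset P) (p : P), ∑ p' ∈ s, κ p p' ≤ 1 / 2) (u : P → H)
    (hu : ∀ p p', p ≠ p' → ‖inner ℂ (u p) (u p')‖ ≤ κ p p' * (‖u p‖ * ‖u p'‖))
    (s : Finset P) :
    |‖∑ p ∈ s, u p‖ ^ 2 - ∑ p ∈ s, ‖u p‖ ^ 2| ≤ 1 / 2 * ∑ p ∈ s, ‖u p‖ ^ 2 := by
  classical
  have h1 : ‖∑ p ∈ s, u p‖ ^ 2 = ∑ p ∈ s, ∑ p' ∈ s, (inner ℂ (u p) (u p')).re := by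
    rw [← inner_self_eq_norm_sq (𝕜 := ℂ), sum_inner]
    simp only [inner_sum, RCLike.re_eq_complex_re, Complex.re_sum]
  have h2 : ∑ p ∈ s, ‖u p‖ ^ 2 = ∑ p ∈ s, ∑ p' ∈ s, if p = p' then ‖u p‖ ^ 2 else 0 := by
    refine Finset.sum_congr rfl fun p hp => ?_
    rw [Finset.sum_ite_eq, if_pos hp]
  have h3 : ∀ p p', |(inner ℂ (u p) (u p')).re - if p = p' then ‖u p‖ ^ 2 else 0|
      ≤ κ p p' * ((‖u p‖ ^ 2 + ‖u p'‖ ^ 2) / 2) := by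
    intro p p'
    have hle : ‖u p‖ * ‖u p'‖ ≤ (‖u p‖ ^ 2 + ‖u p'‖ ^ 2) / 2 := by
      nlinarith [sq_nonneg (‖u p‖ - ‖u p'‖)]
    refine le_trans ?_ (mul_le_mul_of_nonneg_left hle (hκ0 p p'))
    by_cases h : p = p'
    · subst h
      have : (inner ℂ (u p) (u p)).re = ‖u p‖ ^ 2 := inner_self_eq_norm_sq (𝕜 := ℂ) (u p)
      rw [if_pos rfl, this, sub_self, abs_zero]
      exact mul_nonneg (hκ0 _ _) (by positivity)
    · rw [if_neg h, sub_zero]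
      exact (Complex.abs_re_le_norm _).trans (hu p p' h)
  -- By symmetry of κ the two halves produced by the inequality of means are equal, so bounding row
  -- sums suffices.
  have h4 : ∑ p ∈ s, ∑ p' ∈ s, κ p p' * ‖u p'‖ ^ 2 = ∑ p ∈ s, ∑ p' ∈ s, κ p p' * ‖u p‖ ^ 2 := by
    rw [Finset.sum_comm]
    simp only [hκs]
  calc |‖∑ p ∈ s, u p‖ ^ 2 - ∑ p ∈ s, ‖u p‖ ^ 2|
      = |∑ p ∈ s, ∑ p' ∈ s, ((inner ℂ (u p) (u p')).re - if p = p' then ‖u p‖ ^ 2 else 0)| := by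
        rw [h1, h2]
        simp only [Finset.sum_sub_distrib]
    _ ≤ ∑ p ∈ s, ∑ p' ∈ s, κ p p' * ((‖u p‖ ^ 2 + ‖u p'‖ ^ 2) / 2) :=
        (Finset.abs_sum_le_sum_abs _ _).trans (Finset.sum_le_sum fun p _ =>
          (Finset.abs_sum_le_sum_abs _ _).trans (Finset.sum_le_sum fun p' _ => h3 p p'))
    _ = (∑ p ∈ s, ∑ p' ∈ s, κ p p' * ‖u p‖ ^ 2
          + ∑ p ∈ s, ∑ p' ∈ s, κ p p' * ‖u p'‖ ^ 2) / 2 := by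
        simp only [← Finset.sum_add_distrib, Finset.sum_div]
        exact Finset.sum_congr rfl fun _ _ => Finset.sum_congr rfl fun _ _ => by ring
    _ = ∑ p ∈ s, (∑ p' ∈ s, κ p p') * ‖u p‖ ^ 2 := by
        rw [h4, add_self_div_two]
        simp only [Finset.sum_mul]
    _ ≤ ∑ p ∈ s, 1 / 2 * ‖u p‖ ^ 2 :=
        Finset.sum_le_sum fun p _ => mul_le_mul_of_nonneg_right (hκ s p) (sq_nonneg _)
    _ = _ := by rw [Finset.mul_sum]

end AlmostOrthogonal

/-! ### From finite sums to series -/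

section Summability

variable {P H : Type*} [NormedAddCommGroup H]

/-- In a complete space unconditional convergence is the Cauchy criterion for finite sums outside a
finite set, and the two-sided estimate turns the criterion for one series into that for the other.
-/
theorem summable_iff_summable_norm_sq [CompleteSpace H] {A B : ℝ} (hA : 0 < A) (hB : 0 < B)
    {u : P → H}
    (h1 : ∀ s : Finset P, A * ∑ p ∈ s, ‖u p‖ ^ 2 ≤ ‖∑ p ∈ s, u p‖ ^ 2)
    (h2 : ∀ s : Finset P, ‖∑ p ∈ s, u p‖ ^ 2 ≤ B * ∑ p ∈ s, ‖u p‖ ^ 2) :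
    Summable u ↔ Summable fun p => ‖u p‖ ^ 2 := by
  have hn : ∀ t : Finset P, ‖∑ p ∈ t, ‖u p‖ ^ 2‖ = ∑ p ∈ t, ‖u p‖ ^ 2 := fun t =>
    Real.norm_of_nonneg (Finset.sum_nonneg fun _ _ => sq_nonneg _)
  rw [summable_iff_vanishing_norm, summable_iff_vanishing_norm]
  constructor
  · intro h ε hε
    obtain ⟨s, hs⟩ := h (√(A * ε)) (by positivity)
    refine ⟨s, fun t ht => ?_⟩
    rw [hn]
    have h3 := (h1 t).trans_lt ((Real.lt_sqrt (norm_nonneg _)).1 (hs t ht))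
    exact lt_of_mul_lt_mul_left h3 hA.le
  · intro h ε hε
    obtain ⟨s, hs⟩ := h (ε ^ 2 / B) (by positivity)
    refine ⟨s, fun t ht => ?_⟩
    have h3 := hs t ht
    rw [hn, lt_div_iff₀' hB] at h3
    exact lt_of_pow_lt_pow_left₀ 2 hε.le ((h2 t).trans_lt h3)

theorem norm_sq_tsum_bounds {A B : ℝ} {u : P → H}
    (h1 : ∀ s : Finset P, A * ∑ p ∈ s, ‖u p‖ ^ 2 ≤ ‖∑ p ∈ s, u p‖ ^ 2)
    (h2 : ∀ s : Finset P, ‖∑ p ∈ s, u p‖ ^ 2 ≤ B * ∑ p ∈ s, ‖u p‖ ^ 2)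
    (hu : Summable u) (hu2 : Summable fun p => ‖u p‖ ^ 2) :
    A * ∑' p, ‖u p‖ ^ 2 ≤ ‖∑' p, u p‖ ^ 2 ∧ ‖∑' p, u p‖ ^ 2 ≤ B * ∑' p, ‖u p‖ ^ 2 :=
  ⟨le_of_tendsto_of_tendsto' (Filter.Tendsto.const_mul A hu2.hasSum) (hu.hasSum.norm.pow 2) h1,
    le_of_tendsto_of_tendsto' (hu.hasSum.norm.pow 2) (Filter.Tendsto.const_mul B hu2.hasSum) h2⟩

end Summability

/-- The sum of `a ^ |r - t|` over finitely many `t ≠ r`. -/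
theorem sum_pow_dist_le {a : ℝ} (h0 : 0 ≤ a) (h1 : a < 1) (r : ℕ) (s : Finset ℕ) (hr : r ∉ s) :
    ∑ t ∈ s, a ^ Nat.dist r t ≤ 2 * (a / (1 - a)) := by
  -- Each side of r contributes part of one geometric series, indexed by the distance minus one.
  have hgeom : ∀ S : Finset ℕ, ∑ t ∈ S, a ^ (t + 1) ≤ a / (1 - a) := by
    intro S
    simp only [pow_succ', ← Finset.mul_sum, div_eq_mul_inv]
    refine mul_le_mul_of_nonneg_left ?_ h0
    rw [← tsum_geometric_of_lt_one h0 h1]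
    exact (summable_geometric_of_lt_one h0 h1).sum_le_tsum S fun _ _ => by positivity
  rw [← Finset.sum_filter_add_sum_filter_not s (fun t => t < r), two_mul]
  refine add_le_add ?_ ?_
  · refine le_trans (le_of_eq ?_) (hgeom ((s.filter fun t => t < r).image fun t => r - t - 1))
    rw [Finset.sum_image]
    · refine Finset.sum_congr rfl fun t ht => ?_
      have := (Finset.mem_filter.1 ht).2
      congr 1
      simp only [Nat.dist]
      omega
    · intro x hx y hy hxy
      have := (Finset.mem_filter.1 hx).2
      have := (Finset.mem_filter.1 hy).2
      simp only at hxy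
      omega
  · have hlt : ∀ t ∈ s.filter fun t => ¬ t < r, r < t := by
      intro t ht
      have h := Finset.mem_filter.1 ht
      exact lt_of_le_of_ne (not_lt.1 h.2) fun h' => hr (h' ▸ h.1)
    refine le_trans (le_of_eq ?_) (hgeom ((s.filter fun t => ¬ t < r).image fun t => t - r - 1))
    rw [Finset.sum_image]
    · refine Finset.sum_congr rfl fun t ht => ?_
      have := hlt t ht
      congr 1
      simp only [Nat.dist]
      omega
    · intro x hx y hy hxy
      have := hlt x hx
      have := hlt y hy
      simp only at hxy
      omega

/-! ### The vectors `ξ_{r,s}` -/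

section Sandwich

variable {q : Set.Ioo (-1 : ℝ) 1} {V : Type*} [NormedAddCommGroup V] [InnerProductSpace ℝ V]

theorem mem_T_iff {e : V} {k : ℕ} {ξ : Fock q V} :
    ξ ∈ T q e k ↔ ξ ∈ tensorPart q V k ∧ annihilation e ξ = 0 ∧ annihilationR e ξ = 0 := by
  rw [T, Submodule.mem_inf, Submodule.mem_inf, and_assoc]
  rfl

theorem sandwich_zero_zero (e : V) (ξ : Fock q V) : sandwich e ξ 0 0 = ξ := rfl

theorem sandwich_succ_left (e : V) (ξ : Fock q V) (r s : ℕ) :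
    sandwich e ξ (r + 1) s = creation e (sandwich e ξ r s) := by
  rw [sandwich, pow_succ']
  rfl

theorem creationR_creation_pow (e : V) (r : ℕ) (x : Fock q V) :
    creationR e ((creation e ^ r) x) = (creation e ^ r) (creationR e x) := by
  induction r with
  | zero => rfl
  | succ r ih =>
    rw [pow_succ']
    change creationR e (creation e ((creation e ^ r) x)) = creation e ((creation e ^ r) _)
    rw [← creation_creationR, ih]

theorem sandwich_succ_right (e : V) (ξ : Fock q V) (r s : ℕ) :
    sandwich e ξ r (s + 1) = creationR e (sandwich e ξ r s) := by
  rw [sandwich, sandwich, creationR_creation_pow, pow_succ']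
  rfl

theorem sandwich_mem_tensorPart (e : V) {k : ℕ} {ξ : Fock q V} (hξ : ξ ∈ tensorPart q V k)
    (r s : ℕ) : sandwich e ξ r s ∈ tensorPart q V (k + s + r) := by
  induction r with
  | zero =>
    induction s with
    | zero => exact hξ
    | succ s ih =>
      rw [sandwich_succ_right]
      exact creationR_mem_tensorPart e ih
  | succ r ih =>
    rw [sandwich_succ_left]
    exact creation_mem_tensorPart e ih

theorem flipOp_creation (h : V) (x : Fock q V) :
    flipOp (creation h x) = creationR h (flipOp x) := by
  rw [creationR_eq_flipOp, flipOp_flipOp]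

theorem flipOp_creationR (h : V) (x : Fock q V) :
    flipOp (creationR h x) = creation h (flipOp x) := by
  rw [creationR_eq_flipOp, flipOp_flipOp]

theorem flipOp_sandwich (e : V) (ξ : Fock q V) (r s : ℕ) :
    flipOp (sandwich e ξ r s) = sandwich e (flipOp ξ) s r := by
  induction r with
  | zero =>
    induction s with
    | zero => rfl
    | succ s ih => rw [sandwich_succ_right, sandwich_succ_left, flipOp_creationR, ih]
  | succ r ih => rw [sandwich_succ_left, sandwich_succ_right, flipOp_creation, ih]

theorem flipOp_mem_T {e : V} {k : ℕ} {ξ : Fock q V} (hξ : ξ ∈ T q e k) :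
    flipOp ξ ∈ T q e k := by
  rw [mem_T_iff] at hξ ⊢
  obtain ⟨h1, h2, h3⟩ := hξ
  refine ⟨flipOp_mem_tensorPart h1, ?_, ?_⟩
  · have := congrArg flipOp h3
    rwa [annihilationR_eq_flipOp, flipOp_flipOp, map_zero] at this
  · rw [annihilationR_eq_flipOp, flipOp_flipOp, h2, map_zero]

/-- The formula a(e)ξ_{r,s} = [r] ξ_{r-1,s} + q^{r+k}[s] ξ_{r,s-1}, multiplied by 1 - q to avoid
division. Passing a(e) through the right creations first produces q^k + ⋯ + q^{k+s-1}; each left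
creation then multiplies the old terms by q and adds one new term. -/
theorem one_sub_smul_annihilation_sandwich {e : V} (he : ‖e‖ = 1) {k : ℕ} {ξ : Fock q V}
    (hξ : ξ ∈ T q e k) (r s : ℕ) :
    (1 - ((q : ℝ) : ℂ)) • annihilation e (sandwich e ξ r s)
      = (1 - ((q : ℝ) : ℂ) ^ r) • sandwich e ξ (r - 1) s
        + (((q : ℝ) : ℂ) ^ (r + k) * (1 - ((q : ℝ) : ℂ) ^ s)) • sandwich e ξ r (s - 1) := by
  obtain ⟨h1, h2, -⟩ := mem_T_iff.1 hξ
  induction r with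
  | zero =>
    rw [pow_zero, sub_self, zero_smul, zero_add, zero_add]
    induction s with
    | zero => rw [sandwich_zero_zero, h2, pow_zero, sub_self, mul_zero, smul_zero, zero_smul]
    | succ s ih =>
      rw [sandwich_succ_right, annihilation_creationR he (sandwich_mem_tensorPart e h1 0 s),
        smul_add, ← map_smul, ih, map_smul, add_tsub_cancel_right]
      -- For s = 0 the truncated s - 1 forbids rewriting c_r(e)ξ_{0,s-1} as ξ_{0,s}, but the
      -- coefficient is zero.
      rcases s with _ | s
      · rw [pow_zero, sub_self, mul_zero, zero_smul, zero_add, smul_smul]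
        congr 1
        simp only [add_zero]
        ring
      · rw [add_tsub_cancel_right, ← sandwich_succ_right, smul_smul, ← add_smul]
        congr 1
        ring
  | succ r ih =>
    rw [sandwich_succ_left, annihilation_creation he, smul_add, smul_comm _ ((q : ℝ) : ℂ),
      ← map_smul (creation e), ih, map_add, map_smul, map_smul, add_tsub_cancel_right,
      sandwich_succ_left e ξ r (s - 1)]
    rcases r with _ | r
    · simp only [pow_zero, sub_self, zero_smul, zero_add, pow_one, smul_smul]
      congr 2
      ring
    · rw [add_tsub_cancel_right, ← sandwich_succ_left e ξ r s, smul_add, smul_smul, smul_smul,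
        ← add_assoc, ← add_smul]
      congr 2 <;> ring

theorem one_sub_smul_annihilationR_sandwich {e : V} (he : ‖e‖ = 1) {k : ℕ} {ξ : Fock q V}
    (hξ : ξ ∈ T q e k) (r s : ℕ) :
    (1 - ((q : ℝ) : ℂ)) • annihilationR e (sandwich e ξ r s)
      = (1 - ((q : ℝ) : ℂ) ^ s) • sandwich e ξ r (s - 1)
        + (((q : ℝ) : ℂ) ^ (s + k) * (1 - ((q : ℝ) : ℂ) ^ r)) • sandwich e ξ (r - 1) s := by
  rw [annihilationR_eq_flipOp, flipOp_sandwich, ← map_smul,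
    one_sub_smul_annihilation_sandwich he (flipOp_mem_T hξ), map_add, map_smul, map_smul,
    flipOp_sandwich, flipOp_sandwich, flipOp_flipOp]

/-- Creation operators are moved from the left argument onto the right one as annihilators, one
factor 1 - q being spent on each. The degree entering `gram` is therefore that of ξ'; once r = s =
0, any creation operator left on ξ' pairs to zero since ξ is annihilated. -/
theorem inner_sandwich {e : V} (he : ‖e‖ = 1) {k k' : ℕ} {ξ ξ' : Fock q V} (hξ : ξ ∈ T q e k)
    (hξ' : ξ' ∈ T q e k') (r s r' s' : ℕ) :
    (1 - ((q : ℝ) : ℂ)) ^ (r + s) * inner ℂ (sandwich e ξ r s) (sandwich e ξ' r' s')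
      = (gram q k' r s r' s' : ℂ) * inner ℂ ξ ξ' := by
  obtain ⟨-, h2, h3⟩ := mem_T_iff.1 hξ
  induction r generalizing r' s' with
  | zero =>
    induction s generalizing r' s' with
    | zero =>
      rw [sandwich_zero_zero, add_zero, pow_zero, one_mul, gram]
      rcases r' with _ | r'
      · rcases s' with _ | s'
        · simp [sandwich_zero_zero]
        · rw [sandwich_succ_right, ← inner_conj_symm, inner_creationR, h3, inner_zero_right]
          simp
      · rw [sandwich_succ_left, ← inner_conj_symm, inner_creation, h2, inner_zero_right]
        simp
    | succ s ih =>
      rw [sandwich_succ_right, inner_creationR, ← add_assoc, pow_succ, mul_assoc,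
        ← inner_smul_right, one_sub_smul_annihilationR_sandwich he hξ', inner_add_right,
        inner_smul_right, inner_smul_right, mul_add, mul_left_comm, ih, mul_left_comm (_ ^ (0 + s)), ih,
        gram]
      push_cast
      ring
  | succ r ih =>
    rw [sandwich_succ_left, inner_creation, add_right_comm, pow_succ, mul_assoc,
      ← inner_smul_right, one_sub_smul_annihilation_sandwich he hξ', inner_add_right,
      inner_smul_right, inner_smul_right, mul_add, mul_left_comm, ih, mul_left_comm (_ ^ (r + s)), ih,
      gram]
    push_cast
    ring

/-! ### Estimates for the normalized vectors -/

theorem one_sub_coe_pos (q : Set.Ioo (-1 : ℝ) 1) : 0 < 1 - (q : ℝ) := by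
  linarith [q.2.2]

theorem norm_inner_sandwich {e : V} (he : ‖e‖ = 1) {k k' : ℕ} {ξ ξ' : Fock q V}
    (hξ : ξ ∈ T q e k) (hξ' : ξ' ∈ T q e k') (r s r' s' : ℕ) :
    (1 - (q : ℝ)) ^ (r + s) * ‖(inner ℂ (sandwich e ξ r s) (sandwich e ξ' r' s') : ℂ)‖
      = |gram q k' r s r' s'| * ‖(inner ℂ ξ ξ' : ℂ)‖ := by
  have h := congrArg norm (inner_sandwich he hξ hξ' r s r' s')
  rw [norm_mul, norm_mul, norm_pow, Complex.norm_real, Real.norm_eq_abs, ← Complex.ofReal_one,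
    ← Complex.ofReal_sub, Complex.norm_real, Real.norm_of_nonneg (one_sub_coe_pos q).le] at h
  exact h

theorem half_le_norm_sandwich_sq {e : V} (he : ‖e‖ = 1) (hq : |(q : ℝ)| ≤ 1 / 40) {k : ℕ}
    (hk : 1 ≤ k) {ξ : Fock q V} (hξ : ξ ∈ T q e k) (hξ1 : ‖ξ‖ = 1) (r s : ℕ) :
    1 / 2 ≤ (1 - (q : ℝ)) ^ (r + s) * ‖sandwich e ξ r s‖ ^ 2 := by
  have h := norm_inner_sandwich he hξ hξ r s r s
  rw [inner_self_eq_norm_sq_to_K, inner_self_eq_norm_sq_to_K, hξ1] at h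
  simp only [norm_pow, RCLike.norm_ofReal, abs_norm, abs_one, one_pow, mul_one] at h
  rw [h]
  exact (half_le_gram_diag hq hk r s).trans (le_abs_self _)

/-- Since r + s = r' + s', both norms and the inner product carry the same power of 1 - q. The
constant 8 is the off-diagonal 4 divided by the diagonal lower bound 1/2. -/
theorem norm_inner_sandwich_le {e : V} (he : ‖e‖ = 1) (hq : |(q : ℝ)| ≤ 1 / 40) {k : ℕ}
    (hk : 1 ≤ k) {ξ : Fock q V} (hξ : ξ ∈ T q e k) (hξ1 : ‖ξ‖ = 1) {r s r' s' : ℕ}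
    (h : r + s = r' + s') :
    ‖(inner ℂ (sandwich e ξ r s) (sandwich e ξ r' s') : ℂ)‖
      ≤ 8 * |(q : ℝ)| ^ Nat.dist r r' * (‖sandwich e ξ r s‖ * ‖sandwich e ξ r' s'‖) := by
  have h1 := half_le_norm_sandwich_sq he hq hk hξ hξ1 r s
  have h2 := half_le_norm_sandwich_sq he hq hk hξ hξ1 r' s'
  have h3 := norm_inner_sandwich he hξ hξ r s r' s'
  rw [inner_self_eq_norm_sq_to_K (𝕜 := ℂ) ξ, hξ1] at h3
  simp only [norm_pow, RCLike.norm_ofReal, abs_one, one_pow, mul_one] at h3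
  have h4 := abs_gram_le hq hk r s r' s' h
  rw [← h] at h2
  set w := (1 - (q : ℝ)) ^ (r + s)
  have hw : 0 < w := pow_pos (one_sub_coe_pos q) _
  set a := ‖sandwich e ξ r s‖
  set b := ‖sandwich e ξ r' s'‖
  have ha : 0 ≤ a := norm_nonneg _
  have hb : 0 ≤ b := norm_nonneg _
  have h5 : 1 / 2 ≤ w * (a * b) := by
    -- The geometric mean of the two diagonal bounds.
    refine le_of_sq_le_sq ?_ (by positivity)
    have := mul_le_mul h1 h2 (by norm_num) (by positivity)
    calc (1 / 2 : ℝ) ^ 2 = 1 / 2 * (1 / 2) := by ring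
      _ ≤ w * a ^ 2 * (w * b ^ 2) := this
      _ = (w * (a * b)) ^ 2 := by ring
  refine le_of_mul_le_mul_left ?_ hw
  rw [h3]
  have h6 : 0 ≤ 8 * |(q : ℝ)| ^ Nat.dist r r' := by positivity
  calc _ ≤ 4 * |(q : ℝ)| ^ Nat.dist r r' := h4
    _ = 8 * |(q : ℝ)| ^ Nat.dist r r' * (1 / 2) := by ring
    _ ≤ 8 * |(q : ℝ)| ^ Nat.dist r r' * (w * (a * b)) := mul_le_mul_of_nonneg_left h5 h6
    _ = _ := by ring

theorem inner_sandwich_eq_zero {e : V} (he : ‖e‖ = 1) {k k' : ℕ} {ξ ξ' : Fock q V}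
    (hξ : ξ ∈ T q e k) (hξ' : ξ' ∈ T q e k') {r s r' s' : ℕ}
    (h : r + s = r' + s' → inner ℂ ξ ξ' = 0) :
    inner ℂ (sandwich e ξ r s) (sandwich e ξ' r' s') = 0 := by
  have h1 := inner_sandwich he hξ hξ' r s r' s'
  have h2 : (1 - ((q : ℝ) : ℂ)) ^ (r + s) ≠ 0 := by
    refine pow_ne_zero _ ?_
    have := (one_sub_coe_pos q).ne'
    exact_mod_cast this
  by_cases h3 : r + s = r' + s'
  · rw [h h3, mul_zero] at h1
    exact (mul_eq_zero.1 h1).resolve_left h2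
  · rw [gram_eq_zero _ _ _ _ _ _ h3, Complex.ofReal_zero, zero_mul] at h1
    exact (mul_eq_zero.1 h1).resolve_left h2

end Sandwich

/-! ### The vacuum vector and the cyclic subspaces -/

section Vacuum

variable {q : Set.Ioo (-1 : ℝ) 1} {V : Type*} [NormedAddCommGroup V] [InnerProductSpace ℝ V]

theorem vacuum_mem_tensorPart : vacuum q V ∈ tensorPart q V 0 :=
  coe_of_mem_tensorPart _ _

theorem vacuum_mem_T (e : V) : vacuum q V ∈ T q e 0 := by
  refine mem_T_iff.2 ⟨vacuum_mem_tensorPart, annihilation_eq_zero e vacuum_mem_tensorPart, ?_⟩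
  rw [annihilationR_eq_flipOp, annihilation_eq_zero e (flipOp_mem_tensorPart vacuum_mem_tensorPart),
    map_zero]

theorem tensorPart_zero_le {S : Submodule ℂ (Fock q V)} (hS : IsClosed (S : Set (Fock q V)))
    (h : vacuum q V ∈ S) : tensorPart q V 0 ≤ S := by
  refine tensorPart_le hS fun t => ?_
  induction t using PiTensorProduct.induction_on with
  | add y y' hy hy' =>
    rw [map_add, UniformSpace.Completion.coe_add]
    exact S.add_mem hy hy'
  | smul_tprod r w =>
    rw [map_smul, UniformSpace.Completion.coe_smul, Subsingleton.elim w Fin.elim0]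
    exact S.smul_mem r h

theorem creationR_vacuum (h : V) : creationR h (vacuum q V) = creation h (vacuum q V) := by
  rw [vacuum, creationR_word, creation_word]
  congr 1
  funext i
  obtain rfl : i = 0 := Fin.eq_zero i
  rfl

/-- For the vacuum, left and right creations by e agree, so Ω_{r,s} depends on r + s only. This
redundancy is why degree 0 is kept apart from the families ξ_{r,s}. -/
theorem creationR_sandwich_vacuum (e : V) (n : ℕ) :
    creationR e (sandwich e (vacuum q V) n 0) = sandwich e (vacuum q V) (n + 1) 0 := by
  rw [sandwich, creationR_creation_pow]
  change (creation e ^ n) (creationR e (vacuum q V)) = (creation e ^ (n + 1)) (vacuum q V)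
  rw [creationR_vacuum, pow_succ]
  rfl

variable (q) in
/-- The closed linear span of the vectors `e^{⊗ n}`. -/
noncomputable def powerSpan (e : V) : Submodule ℂ (Fock q V) :=
  (Submodule.span ℂ (Set.range fun n => sandwich e (vacuum q V) n 0)).topologicalClosure

theorem sandwich_vacuum_mem (e : V) (n : ℕ) : sandwich e (vacuum q V) n 0 ∈ powerSpan q e :=
  Submodule.le_topologicalClosure _ (Submodule.subset_span ⟨n, rfl⟩)

theorem closure_span_le {H : Type*} [NormedAddCommGroup H] [InnerProductSpace ℂ H] {s : Set H}
    {S : Submodule ℂ H} (hS : IsClosed (S : Set H)) (h : s ⊆ S) :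
    (Submodule.span ℂ s).topologicalClosure ≤ S :=
  Submodule.topologicalClosure_minimal _ (Submodule.span_le.2 h) hS

theorem sandwich_mem_orthogonal_powerSpan {e : V} (he : ‖e‖ = 1) {k : ℕ} {ξ : Fock q V}
    (hξ : ξ ∈ T q e (k + 1)) (r s : ℕ) : sandwich e ξ r s ∈ (powerSpan q e)ᗮ := by
  have h : powerSpan q e ≤ (ℂ ∙ sandwich e ξ r s)ᗮ := by
    refine closure_span_le (Submodule.isClosed_orthogonal _) ?_
    rintro _ ⟨n, rfl⟩
    refine Submodule.mem_orthogonal_singleton_iff_inner_left.2 ?_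
    exact inner_sandwich_eq_zero he (vacuum_mem_T e) hξ fun _ =>
      inner_eq_zero_of_mem_tensorPart (by omega) vacuum_mem_tensorPart (mem_T_iff.1 hξ).1
  exact (Submodule.mem_orthogonal _ _).2 fun u hu =>
    Submodule.mem_orthogonal_singleton_iff_inner_left.1 (h hu)

variable (q) in
/-- The vectors `ξ_{r,s}` with `ξ ∈ T^{k + 1}`, together with the vectors `e^{⊗ n}`. -/
def sandwichSet (e : V) : Set (Fock q V) :=
  {x | ∃ k, ∃ ξ ∈ T q e (k + 1), ∃ r s, x = sandwich e ξ r s}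
    ∪ Set.range fun n => sandwich e (vacuum q V) n 0

/-- The vectors `ξ_{r,s}` and `e^{⊗ n}` span a dense subspace of the `q`-Fock space. -/
theorem closure_span_sandwichSet (e : V) :
    (Submodule.span ℂ (sandwichSet q e)).topologicalClosure = ⊤ := by
  set L := (Submodule.span ℂ (sandwichSet q e)).topologicalClosure with hL
  have hLc : IsClosed (L : Set (Fock q V)) := Submodule.isClosed_topologicalClosure _
  have hmem : ∀ x ∈ sandwichSet q e, x ∈ L := fun x hx =>
    Submodule.le_topologicalClosure _ (Submodule.subset_span hx)
  -- The closed span is invariant under c(e) and c_r(e) because the generating set is.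
  have hc : L ≤ L.comap (creation (q := q) e).toLinearMap := by
    refine closure_span_le (isClosed_comap hLc (creation e)) ?_
    rintro _ (⟨k, ξ, hξ, r, s, rfl⟩ | ⟨n, rfl⟩)
    · exact hmem _ (Or.inl ⟨k, ξ, hξ, r + 1, s, (sandwich_succ_left e ξ r s).symm⟩)
    · exact hmem _ (Or.inr ⟨n + 1, sandwich_succ_left e _ n 0⟩)
  have hcR : L ≤ L.comap (creationR (q := q) e).toLinearMap := by
    refine closure_span_le (isClosed_comap hLc (creationR e)) ?_
    rintro _ (⟨k, ξ, hξ, r, s, rfl⟩ | ⟨n, rfl⟩)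
    · exact hmem _ (Or.inl ⟨k, ξ, hξ, r, s + 1, (sandwich_succ_right e ξ r s).symm⟩)
    · exact hmem _ (Or.inr ⟨n + 1, (creationR_sandwich_vacuum e n).symm⟩)
  refine eq_top_of_tensorPart_le hLc fun n => ?_
  induction n with
  | zero => exact tensorPart_zero_le hLc (hmem _ (Or.inr ⟨0, rfl⟩))
  | succ n ih =>
    intro x hx
    have hN : IsClosed ((L ⊓ tensorPart q V (n + 1) : Submodule ℂ (Fock q V)) : Set (Fock q V)) :=
      hLc.inter (isClosed_tensorPart (n + 1))
    have : CompleteSpace (L ⊓ tensorPart q V (n + 1) : Submodule ℂ (Fock q V)) :=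
      hN.completeSpace_coe
    -- Splitting off the part already reached leaves a remainder in H^{⊗(n+1)} that turns out to lie
    -- in T^{n+1}, hence in `L`.
    obtain ⟨y, hy, z, hz, rfl⟩ :=
      Submodule.exists_add_mem_mem_orthogonal (K := L ⊓ tensorPart q V (n + 1)) x
    have hz' : z ∈ tensorPart q V (n + 1) := by
      have := (tensorPart q V (n + 1)).sub_mem hx hy.2
      rwa [add_sub_cancel_left] at this
    -- By induction a(e)z is in `L`, so c(e)a(e)z is in `L` and in degree n + 1, hence orthogonal to
    -- z; but ⟨c(e)a(e)z, z⟩ = ‖a(e)z‖².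
    have hz1 : annihilation e z = 0 := by
      rw [← inner_self_eq_zero (𝕜 := ℂ), ← inner_creation]
      have hm := annihilation_mem_tensorPart e hz'
      exact hz _ ⟨hc (ih hm), creation_mem_tensorPart e hm⟩
    have hz2 : annihilationR e z = 0 := by
      rw [← inner_self_eq_zero (𝕜 := ℂ), ← inner_creationR]
      have hm := annihilationR_mem_tensorPart e hz'
      exact hz _ ⟨hcR (ih hm), creationR_mem_tensorPart e hm⟩
    exact L.add_mem hy.1 (hmem _ (Or.inl ⟨n, z, mem_T_iff.2 ⟨hz', hz1, hz2⟩, 0, 0, rfl⟩))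

end Vacuum

/-! ### The spaces `L²(M)` and `L²(A)` -/

section L2

variable {q : Set.Ioo (-1 : ℝ) 1} {V : Type*} [NormedAddCommGroup V] [InnerProductSpace ℝ V]

theorem mem_generatedVN_iff {H : Type*} [NormedAddCommGroup H] [InnerProductSpace ℂ H]
    [CompleteSpace H] {S : Set (H →L[ℂ] H)} {x : H →L[ℂ] H} :
    x ∈ generatedVN S ↔
      x ∈ StarSubalgebra.centralizer ℂ (StarSubalgebra.centralizer ℂ S : Set (H →L[ℂ] H)) :=
  Iff.rfl

theorem mem_generatedVN {H : Type*} [NormedAddCommGroup H] [InnerProductSpace ℂ H]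
    [CompleteSpace H] {S : Set (H →L[ℂ] H)} {x : H →L[ℂ] H} (hx : x ∈ S) : x ∈ generatedVN S := by
  rw [mem_generatedVN_iff, StarSubalgebra.mem_centralizer_iff]
  intro g hg
  have h1 := (StarSubalgebra.mem_centralizer_iff ℂ).1 hg x hx
  have h2 := (StarSubalgebra.mem_centralizer_iff ℂ).1 (star_mem hg) x hx
  exact ⟨h1.1.symm, h2.1.symm⟩

theorem isClosed_L2 (N : VonNeumannAlgebra (Fock q V)) : IsClosed (L2 N : Set (Fock q V)) :=
  Submodule.isClosed_topologicalClosure _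

theorem vacuum_mem_L2 (N : VonNeumannAlgebra (Fock q V)) : vacuum q V ∈ L2 N :=
  Submodule.le_topologicalClosure _ (Submodule.subset_span ⟨1, one_mem N, rfl⟩)

theorem apply_mem_L2 {N : VonNeumannAlgebra (Fock q V)} {x : Fock q V →L[ℂ] Fock q V}
    (hx : x ∈ N) {ξ : Fock q V} (hξ : ξ ∈ L2 N) : x ξ ∈ L2 N := by
  refine closure_span_le (isClosed_comap (isClosed_L2 N) x) ?_ hξ
  rintro _ ⟨y, hy, rfl⟩
  exact Submodule.le_topologicalClosure _ (Submodule.subset_span ⟨x * y, mul_mem hx hy, rfl⟩)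

theorem creation_apply_eq (h : V) (x : Fock q V) :
    creation h x = field h x - annihilation h x := by
  rw [field, add_apply, add_sub_cancel_right]

/-- Creation operators are indexed by real vectors, so a complex first letter is split into real and
imaginary parts. -/
theorem of_cons_eq {n : ℕ} (a b : V) (w : Fin n → Complexification V) :
    ((AlgFock.of (n + 1) (PiTensorProduct.tprod ℂ (Fin.cons (Complexification.ofReal a
        + Complex.I • Complexification.ofReal b) w : Fin (n + 1) → Complexification V)) :
          AlgFock q (Complexification V)) : Fock q V)
      = creation a (word w) + Complex.I • creation b (word w) := by
  rw [creation_word, creation_word, MultilinearMap.cons_add, MultilinearMap.cons_smul, map_add,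
    map_smul, UniformSpace.Completion.coe_add, UniformSpace.Completion.coe_smul]
  rfl

/-- The vacuum vector is cyclic for the `q`-Gaussian algebra. -/
theorem L2_gaussianAlgebra : L2 (gaussianAlgebra q V) = ⊤ := by
  have hcl := isClosed_L2 (gaussianAlgebra q V)
  refine eq_top_of_tensorPart_le hcl fun n => ?_
  induction n using Nat.strong_induction_on with
  | _ n ih =>
    rcases n with _ | n
    · exact tensorPart_zero_le hcl (vacuum_mem_L2 _)
    -- c(h)x = s(h)x - a(h)x, where a(h)x has degree n - 1 (or vanishes); hence strong induction.
    have hc : ∀ (h : V) (x : Fock q V), x ∈ tensorPart q V n →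
        creation h x ∈ L2 (gaussianAlgebra q V) := by
      intro h x hx
      rw [creation_apply_eq]
      refine Submodule.sub_mem _ (apply_mem_L2
        (mem_generatedVN (Set.mem_range_self h)) (ih n (by omega) hx)) ?_
      rcases n with _ | n
      · rw [annihilation_eq_zero h hx]
        exact Submodule.zero_mem _
      · exact ih n (by omega) (annihilation_mem_tensorPart h hx)
    refine tensorPart_le hcl fun t => ?_
    induction t using PiTensorProduct.induction_on with
    | add y y' hy hy' =>
      rw [map_add, UniformSpace.Completion.coe_add]
      exact Submodule.add_mem _ hy hy'
    | smul_tprod r w =>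
      change Fin (n + 1) → Complexification V at w
      rw [map_smul, UniformSpace.Completion.coe_smul]
      refine Submodule.smul_mem _ r ?_
      obtain ⟨a, b, hab⟩ := Complexification.exists_eq (V := V) (w 0)
      have hw : w 0 = Complexification.ofReal a + Complex.I • Complexification.ofReal b := by
        rw [hab, Complexification.ofReal, Complexification.ofReal]
        refine congrArg _ ?_
        refine Eq.trans ?_ (TensorProduct.smul_tmul' Complex.I (1 : ℂ) b).symm
        rw [smul_eq_mul, mul_one]
      rw [← Fin.cons_self_tail w, hw, of_cons_eq]
      exact Submodule.add_mem _ (hc a _ (coe_of_mem_tensorPart _ _))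
        (Submodule.smul_mem _ _ (hc b _ (coe_of_mem_tensorPart _ _)))

/-- Needed because A is generated by all s(te), while invariance of `powerSpan` is checked for s(e)
only. -/
theorem creation_smul (t : ℝ) (h : V) : creation (q := q) (t • h) = (t : ℂ) • creation h := by
  have hof : Complexification.ofReal (t • h) = (t : ℂ) • Complexification.ofReal h := by
    rw [Complexification.ofReal, Complexification.ofReal]
    refine Eq.trans ?_ (TensorProduct.smul_tmul' (t : ℂ) (1 : ℂ) h).symm
    rw [← TensorProduct.smul_tmul]
    simp only [Complex.real_smul, mul_one, smul_eq_mul]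
    rfl
  ext x
  rw [smul_apply]
  induction x using UniformSpace.Completion.induction_on with
  | hp =>
    exact isClosed_eq (creation (t • h)).continuous ((t : ℂ) • creation h).continuous
  | ih x =>
    rw [creation_coe, creation_coe, ← UniformSpace.Completion.coe_smul, hof]
    congr 1
    refine AlgFock.induction_on x (by simp) (fun n s => ?_) fun x x' hx hx' => by
      simp only [map_add, hx, hx', smul_add]
    rw [AlgFock.create, AlgFock.graded_of, AlgFock.create, AlgFock.graded_of, ← map_smul]
    congr 1
    induction s using PiTensorProduct.induction_on with
    | add y y' hy hy' => simp only [map_add, hy, hy', smul_add]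
    | smul_tprod r w =>
      rw [map_smul, map_smul, tensorCons_tprod, tensorCons_tprod, MultilinearMap.cons_smul,
        smul_comm]

theorem field_smul (t : ℝ) (h : V) : field (q := q) (t • h) = (t : ℂ) • field h := by
  rw [field, field, annihilation, annihilation, creation_smul, smul_add]
  congr 1
  rw [map_smulₛₗ, Complex.conj_ofReal]

theorem inner_field (h : V) (x y : Fock q V) :
    inner ℂ (field h x) y = inner ℂ x (field h y) := by
  rw [field, add_apply, add_apply, inner_add_left, inner_add_right, inner_creation, add_comm,
    annihilation, ContinuousLinearMap.adjoint_inner_left]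

theorem adjoint_field (h : V) : (field (q := q) h).adjoint = field h :=
  ((ContinuousLinearMap.eq_adjoint_iff _ _).2 fun x y => inner_field h x y).symm

/-- The orthogonal projection onto an invariant subspace of a symmetric operator commutes with
the operator. -/
theorem commute_starProjection {H : Type*} [NormedAddCommGroup H] [InnerProductSpace ℂ H]
    {K : Submodule ℂ H} [K.HasOrthogonalProjection] {f : H →L[ℂ] H}
    (hf : ∀ x y, inner ℂ (f x) y = inner ℂ x (f y)) (hK : ∀ x ∈ K, f x ∈ K) :
    f * K.starProjection = K.starProjection * f := by
  ext x
  change f (K.starProjection x) = K.starProjection (f x)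
  symm
  -- The projection of f x is characterized by f(Px) ∈ K and f(x - Px) ⟂ K; the latter uses symmetry
  -- to move f onto K.
  refine Submodule.eq_starProjection_of_mem_orthogonal
    (hK _ (Submodule.starProjection_apply_mem _ _)) ?_
  rw [← map_sub, Submodule.mem_orthogonal]
  intro u hu
  rw [← hf]
  exact (Submodule.mem_orthogonal _ _).1 (Submodule.sub_starProjection_mem_orthogonal x) _ (hK u hu)

theorem annihilation_sandwich_vacuum_succ {e : V} (he : ‖e‖ = 1) (n : ℕ) :
    annihilation e (sandwich e (vacuum q V) (n + 1) 0)
      = ((1 - ((q : ℝ) : ℂ))⁻¹ * (1 - ((q : ℝ) : ℂ) ^ (n + 1))) • sandwich e (vacuum q V) n 0 := by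
  have h := one_sub_smul_annihilation_sandwich he (vacuum_mem_T (q := q) e) (n + 1) 0
  have h2 : (1 - ((q : ℝ) : ℂ)) ≠ 0 := by
    have := (one_sub_coe_pos q).ne'
    exact_mod_cast this
  rw [pow_zero, sub_self, mul_zero, zero_smul, add_zero, add_tsub_cancel_right] at h
  rw [mul_smul, ← h, inv_smul_smul₀ h2]

theorem annihilation_vacuum (e : V) : annihilation e (vacuum q V) = 0 :=
  annihilation_eq_zero e vacuum_mem_tensorPart

theorem field_mem_powerSpan {e : V} (he : ‖e‖ = 1) {x : Fock q V} (hx : x ∈ powerSpan q e) :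
    field e x ∈ powerSpan q e := by
  have hcl : IsClosed (powerSpan q e : Set (Fock q V)) := Submodule.isClosed_topologicalClosure _
  refine closure_span_le (isClosed_comap hcl (field e)) ?_ hx
  rintro _ ⟨n, rfl⟩
  change creation e (sandwich e (vacuum q V) n 0) + annihilation e (sandwich e (vacuum q V) n 0)
    ∈ powerSpan q e
  refine Submodule.add_mem _ ?_ ?_
  · rw [← sandwich_succ_left]
    exact sandwich_vacuum_mem e _
  · rcases n with _ | n
    · rw [sandwich_zero_zero, annihilation_vacuum]
      exact Submodule.zero_mem _
    · rw [annihilation_sandwich_vacuum_succ he]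
      exact Submodule.smul_mem _ _ (sandwich_vacuum_mem e n)

/-- The space `L²(A)` of the generator subalgebra is spanned by the vectors `e^{⊗ n}`. -/
theorem L2_generatorSubalgebra {e : V} (he : ‖e‖ = 1) :
    L2 (generatorSubalgebra q e) = powerSpan q e := by
  have hcl : IsClosed (powerSpan q e : Set (Fock q V)) := Submodule.isClosed_topologicalClosure _
  apply le_antisymm
  · refine closure_span_le hcl ?_
    rintro _ ⟨x, hx, rfl⟩
    have : CompleteSpace (powerSpan q e) := hcl.completeSpace_coe
    -- The projection commutes with the generators of A, hence with every x in the double commutant;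
    -- it fixes Ω, so xΩ = xPΩ = PxΩ stays in the subspace.
    have hP : (powerSpan q e).starProjection ∈
        StarSubalgebra.centralizer ℂ (field '' (Submodule.span ℝ {e} : Set V)) := by
      rw [StarSubalgebra.mem_centralizer_iff]
      rintro _ ⟨h, hh, rfl⟩
      obtain ⟨t, rfl⟩ := Submodule.mem_span_singleton.1 hh
      have hcomm := commute_starProjection (K := powerSpan q e) (f := field (t • e))
        (inner_field _) fun y hy => by
          rw [field_smul]
          exact Submodule.smul_mem _ _ (field_mem_powerSpan he hy)
      rw [ContinuousLinearMap.star_eq_adjoint, adjoint_field]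
      exact ⟨hcomm, hcomm⟩
    have hx' := ((StarSubalgebra.mem_centralizer_iff ℂ).1 (mem_generatedVN_iff.1 hx) _ hP).1
    have hΩ : (powerSpan q e).starProjection (vacuum q V) = vacuum q V :=
      Submodule.starProjection_eq_self_iff.2 (sandwich_vacuum_mem e 0)
    have h := congrArg (fun f : Fock q V →L[ℂ] Fock q V => f (vacuum q V)) hx'
    change (powerSpan q e).starProjection (x (vacuum q V))
      = x ((powerSpan q e).starProjection (vacuum q V)) at h
    rw [hΩ] at h
    exact Submodule.starProjection_eq_self_iff.1 h
  · refine closure_span_le (isClosed_L2 _) ?_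
    rintro _ ⟨n, rfl⟩
    change sandwich e (vacuum q V) n 0 ∈ L2 (generatorSubalgebra q e)
    induction n using Nat.strong_induction_on with
    | _ n ih =>
      rcases n with _ | n
      · exact vacuum_mem_L2 _
      -- e^{⊗(n+1)} = s(e)e^{⊗n} - a(e)e^{⊗n}, and the last vector is zero or a multiple of
      -- e^{⊗(n-1)}.
      rw [sandwich_succ_left, creation_apply_eq]
      refine Submodule.sub_mem _ (apply_mem_L2 (mem_generatedVN
        (Set.mem_image_of_mem field (Submodule.mem_span_singleton_self e))) (ih n (by omega))) ?_
      rcases n with _ | n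
      · rw [sandwich_zero_zero, annihilation_vacuum]
        exact Submodule.zero_mem _
      · rw [annihilation_sandwich_vacuum_succ he]
        exact Submodule.smul_mem _ _ (ih n (by omega))

end L2

/-! ### The Riesz basis -/

section Riesz

variable {q : Set.Ioo (-1 : ℝ) 1} {V : Type*} [NormedAddCommGroup V] [InnerProductSpace ℝ V]

open Classical in
/-- The bound for the entries of the normalized Gram matrix of the vectors `ξ^i_{r,s}`. -/
noncomputable def gramBound {J : Type*} (a : ℝ) (p p' : J × ℕ × ℕ) : ℝ :=
  if p ≠ p' ∧ p.1 = p'.1 ∧ p.2.1 + p.2.2 = p'.2.1 + p'.2.2 then 8 * a ^ Nat.dist p.2.1 p'.2.1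
  else 0

theorem gramBound_nonneg {J : Type*} {a : ℝ} (ha : 0 ≤ a) (p p' : J × ℕ × ℕ) :
    0 ≤ gramBound a p p' := by
  unfold gramBound
  split_ifs <;> positivity

theorem gramBound_comm {J : Type*} (a : ℝ) (p p' : J × ℕ × ℕ) :
    gramBound a p p' = gramBound a p' p := by
  have h : (p ≠ p' ∧ p.1 = p'.1 ∧ p.2.1 + p.2.2 = p'.2.1 + p'.2.2) ↔
      (p' ≠ p ∧ p'.1 = p.1 ∧ p'.2.1 + p'.2.2 = p.2.1 + p.2.2) := by
    rw [ne_comm, eq_comm (a := p.1), eq_comm (a := p.2.1 + p.2.2)]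
  unfold gramBound
  rw [Nat.dist_comm]
  split_ifs with h1 h2 h2
  · rfl
  · exact absurd (h.1 h1) h2
  · exact absurd (h.2 h2) h1
  · rfl

theorem sum_gramBound_le {J : Type*} {a : ℝ} (h0 : 0 ≤ a) (h1 : a ≤ 1 / 40)
    (s : Finset (J × ℕ × ℕ)) (p : J × ℕ × ℕ) : ∑ p' ∈ s, gramBound a p p' ≤ 1 / 2 := by
  classical
  unfold gramBound
  rw [← Finset.sum_filter, ← Finset.mul_sum]
  set S := s.filter fun p' => p ≠ p' ∧ p.1 = p'.1 ∧ p.2.1 + p.2.2 = p'.2.1 + p'.2.2 with hS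
  have hmem : ∀ p' ∈ S, p ≠ p' ∧ p.1 = p'.1 ∧ p.2.1 + p.2.2 = p'.2.1 + p'.2.2 := fun p' h =>
    (Finset.mem_filter.1 h).2
  -- Within a row, ξ and r + s are fixed, so an entry is determined by its first exponent and the
  -- row sum is a sum over r' ≠ r.
  have hinj : Set.InjOn (fun p' : J × ℕ × ℕ => p'.2.1) S := by
    rintro ⟨j, r, t⟩ hx ⟨j', r', t'⟩ hy hxy
    obtain ⟨-, h2, h3⟩ := hmem _ hx
    obtain ⟨-, h5, h6⟩ := hmem _ hy
    simp only at h2 h3 h5 h6 hxy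
    subst hxy
    rw [show t = t' by omega, ← h2, ← h5]
  have hr : p.2.1 ∉ S.image fun p' => p'.2.1 := by
    intro h
    obtain ⟨⟨j, r, t⟩, hp', h'⟩ := Finset.mem_image.1 h
    obtain ⟨h1, h2, h3⟩ := hmem _ hp'
    obtain ⟨j', r', t'⟩ := p
    simp only at h2 h3 h'
    subst h'
    exact h1 (by rw [h2, show t' = t by omega])
  have h2 := sum_pow_dist_le h0 (by linarith) p.2.1 _ hr
  rw [Finset.sum_image hinj] at h2
  -- The row sum is at most 8 · 2 · 1/39 = 16/39 < 1/2.
  have h3 : a / (1 - a) ≤ 1 / 39 := by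
    rw [div_le_div_iff₀ (by linarith) (by norm_num)]
    linarith
  linarith

variable {e : V} {I : ℕ → Type*} (b : ∀ k : ℕ, HilbertBasis (I k) ℂ (T q e (k + 1)))

theorem norm_basis_eq_one (k : ℕ) (i : I k) : ‖(b k i : Fock q V)‖ = 1 :=
  (b k).orthonormal.1 i

theorem inner_basis_eq_zero {j j' : Σ k, I k} (h : j ≠ j') :
    inner ℂ (b j.1 j.2 : Fock q V) (b j'.1 j'.2 : Fock q V) = 0 := by
  obtain ⟨k, i⟩ := j
  obtain ⟨k', i'⟩ := j'
  by_cases hk : k = k'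
  · subst hk
    have hi : i ≠ i' := fun hi => h (by rw [hi])
    exact (b k).orthonormal.2 hi
  · exact inner_eq_zero_of_mem_tensorPart (by simpa using hk) (mem_T_iff.1 (b k i).2).1
      (mem_T_iff.1 (b k' i').2).1

theorem norm_inner_basis_le (he : ‖e‖ = 1) (hq : |(q : ℝ)| ≤ 1 / 40)
    {p p' : (Σ k, I k) × ℕ × ℕ} (hp : p ≠ p') :
    ‖(inner ℂ (sandwich e (b p.1.1 p.1.2 : Fock q V) p.2.1 p.2.2)
        (sandwich e (b p'.1.1 p'.1.2 : Fock q V) p'.2.1 p'.2.2) : ℂ)‖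
      ≤ gramBound |(q : ℝ)| p p' * (‖sandwich e (b p.1.1 p.1.2 : Fock q V) p.2.1 p.2.2‖
        * ‖sandwich e (b p'.1.1 p'.1.2 : Fock q V) p'.2.1 p'.2.2‖) := by
  by_cases h : p.1 = p'.1 ∧ p.2.1 + p.2.2 = p'.2.1 + p'.2.2
  · rw [gramBound, if_pos ⟨hp, h⟩, ← h.1]
    exact norm_inner_sandwich_le he hq (by omega) (b p.1.1 p.1.2).2 (norm_basis_eq_one b _ _) h.2
  · rw [inner_sandwich_eq_zero he (b p.1.1 p.1.2).2 (b p'.1.1 p'.1.2).2, norm_zero]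
    · exact mul_nonneg (gramBound_nonneg (abs_nonneg _) _ _) (by positivity)
    · exact fun h2 => inner_basis_eq_zero b fun h1 => h ⟨h1, h2⟩

theorem sandwich_basis_ne_zero (he : ‖e‖ = 1) (hq : |(q : ℝ)| ≤ 1 / 40) {k : ℕ} (i : I k)
    (r s : ℕ) : sandwich e (b k i : Fock q V) r s ≠ 0 := by
  intro h
  have := half_le_norm_sandwich_sq he hq (by omega) (b k i).2 (norm_basis_eq_one b k i) r s
  rw [h] at this
  norm_num at this

/-- A closed subspace containing the vectors `ξ^i_{r,s}` for a Hilbert basis of each `T^k`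
contains all the vectors `ξ_{r,s}`. -/
theorem sandwich_mem_of_basis {S : Submodule ℂ (Fock q V)} (hS : IsClosed (S : Set (Fock q V)))
    (h : ∀ k (i : I k) r s, sandwich e (b k i : Fock q V) r s ∈ S) {k : ℕ} {ξ : Fock q V}
    (hξ : ξ ∈ T q e (k + 1)) (r s : ℕ) : sandwich e ξ r s ∈ S := by
  let f : T q e (k + 1) →L[ℂ] Fock q V :=
    ((creation e ^ r).comp (creationR e ^ s)).comp (T q e (k + 1)).subtypeL
  have hcl : IsClosed ((S.comap f.toLinearMap : Submodule ℂ (T q e (k + 1))) :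
      Set (T q e (k + 1))) := hS.preimage f.continuous
  have hle : ⊤ ≤ S.comap f.toLinearMap := by
    rw [← (b k).dense_span]
    refine closure_span_le hcl ?_
    rintro _ ⟨i, rfl⟩
    exact h k i r s
  exact hle (Submodule.mem_top (x := (⟨ξ, hξ⟩ : T q e (k + 1))))

/-- A vector orthogonal both to the normalized family and to all e^{⊗n} is orthogonal to a total
set, hence zero; so the family exhausts the complement of `powerSpan`. -/
theorem closure_span_normalized_basis (he : ‖e‖ = 1) (hq : |(q : ℝ)| ≤ 1 / 40)
    {ξ : (Σ k, I k) × ℕ × ℕ → Fock q V}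
    (hξ : ∀ k (i : I k) r s, ξ (⟨k, i⟩, r, s) = sandwich e (b k i : Fock q V) r s) :
    (Submodule.span ℂ (Set.range fun p => (‖ξ p‖⁻¹ : ℂ) • ξ p)).topologicalClosure
      = (powerSpan q e)ᗮ := by
  set K := (Submodule.span ℂ (Set.range fun p => (‖ξ p‖⁻¹ : ℂ) • ξ p)).topologicalClosure
  have hKc : IsClosed (K : Set (Fock q V)) := Submodule.isClosed_topologicalClosure _
  have hK : K ≤ (powerSpan q e)ᗮ := by
    refine closure_span_le (Submodule.isClosed_orthogonal _) ?_
    rintro _ ⟨⟨⟨k, i⟩, r, s⟩, rfl⟩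
    refine Submodule.smul_mem _ _ ?_
    rw [hξ]
    exact sandwich_mem_orthogonal_powerSpan he (b k i).2 r s
  refine le_antisymm hK fun x hx => ?_
  have : CompleteSpace K := hKc.completeSpace_coe
  obtain ⟨y, hy, z, hz, rfl⟩ := Submodule.exists_add_mem_mem_orthogonal (K := K) x
  have hz' : z ∈ (powerSpan q e)ᗮ := by
    have := Submodule.sub_mem _ hx (hK hy)
    rwa [add_sub_cancel_left] at this
  have hbasis : ∀ k (i : I k) r s, sandwich e (b k i : Fock q V) r s ∈ K := by
    intro k i r s
    have h1 : (‖ξ (⟨k, i⟩, r, s)‖⁻¹ : ℂ) • ξ (⟨k, i⟩, r, s) ∈ K :=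
      Submodule.le_topologicalClosure _ (Submodule.subset_span ⟨(⟨k, i⟩, r, s), rfl⟩)
    rw [hξ] at h1
    have h2 : (‖sandwich e (b k i : Fock q V) r s‖ : ℂ) ≠ 0 := by
      exact_mod_cast norm_ne_zero_iff.2 (sandwich_basis_ne_zero b he hq i r s)
    have h3 := K.smul_mem (‖sandwich e (b k i : Fock q V) r s‖ : ℂ) h1
    rwa [smul_inv_smul₀ h2] at h3
  have htop : (⊤ : Submodule ℂ (Fock q V)) ≤ (ℂ ∙ z)ᗮ := by
    rw [← closure_span_sandwichSet e]
    refine closure_span_le (Submodule.isClosed_orthogonal _) ?_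
    rintro _ (⟨k, ξ', hξ', r, s, rfl⟩ | ⟨n, rfl⟩)
    · exact Submodule.mem_orthogonal_singleton_iff_inner_left.2
        (hz _ (sandwich_mem_of_basis b hKc hbasis hξ' r s))
    · exact Submodule.mem_orthogonal_singleton_iff_inner_left.2 (hz' _ (sandwich_vacuum_mem e n))
  have hz0 : z = 0 := inner_self_eq_zero.1
    (Submodule.mem_orthogonal_singleton_iff_inner_left.1 (htop (Submodule.mem_top (x := z))))
  rw [hz0, add_zero]
  exact hy

/-- The Schur test is invariant under rescaling each vector, so it applies directly to c_p ξ_p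
without normalizing. -/
theorem basis_sum_bounds (he : ‖e‖ = 1) (hq : |(q : ℝ)| ≤ 1 / 40)
    {ξ : (Σ k, I k) × ℕ × ℕ → Fock q V}
    (hξ : ∀ k (i : I k) r s, ξ (⟨k, i⟩, r, s) = sandwich e (b k i : Fock q V) r s)
    (c : (Σ k, I k) × ℕ × ℕ → ℂ) (s : Finset ((Σ k, I k) × ℕ × ℕ)) :
    |‖∑ p ∈ s, c p • ξ p‖ ^ 2 - ∑ p ∈ s, ‖c p • ξ p‖ ^ 2|
      ≤ 1 / 2 * ∑ p ∈ s, ‖c p • ξ p‖ ^ 2 := by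
  refine abs_norm_sq_sum_sub_le (gramBound_nonneg (abs_nonneg (q : ℝ))) (gramBound_comm _)
    (sum_gramBound_le (abs_nonneg _) hq) (fun p => c p • ξ p) (fun p p' hp => ?_) s
  have h := norm_inner_basis_le b he hq hp
  rw [← hξ, ← hξ] at h
  change ‖(inner ℂ (ξ p) (ξ p') : ℂ)‖ ≤ gramBound |(q : ℝ)| p p' * (‖ξ p‖ * ‖ξ p'‖) at h
  rw [inner_smul_left, inner_smul_right, norm_mul, norm_mul, norm_smul, norm_smul,
    RCLike.norm_conj]
  have := mul_le_mul_of_nonneg_left h (by positivity : 0 ≤ ‖c p‖ * ‖c p'‖)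
  linarith

end Riesz

end QFock

/-! ### The theorem -/

theorem theorem3p11 :
    ∃ ε : ℝ, 0 < ε ∧ ∀ q : Set.Ioo (-1 : ℝ) 1, |(q : ℝ)| < ε →
    ∃ A B : ℝ, 0 < A ∧ 0 < B ∧
      ∀ (V : Type*) [NormedAddCommGroup V] [InnerProductSpace ℝ V] [CompleteSpace V]
        (e : V), ‖e‖ = 1 →
      ∀ (I : ℕ → Type*) (b : ∀ k : ℕ, HilbertBasis (I k) ℂ (QFock.T q e (k + 1)))
        (ξ : (Σ k, I k) × ℕ × ℕ → QFock.Fock q V),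
        (∀ k (i : I k) (r s : ℕ),
          ξ (⟨k, i⟩, r, s) = QFock.sandwich e (b k i : QFock.Fock q V) r s) →
        (∀ p, ξ p ≠ 0) ∧
        (Submodule.span ℂ (Set.range fun p => (‖ξ p‖⁻¹ : ℂ) • ξ p)).topologicalClosure
          = QFock.L2 (QFock.gaussianAlgebra q V) ⊓ (QFock.L2 (QFock.generatorSubalgebra q e))ᗮ ∧
        ∀ c : (Σ k, I k) × ℕ × ℕ → ℂ,
          (Summable (fun p => c p • ξ p) ↔ Summable (fun p => ‖c p‖ ^ 2 * ‖ξ p‖ ^ 2)) ∧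
          (Summable (fun p => ‖c p‖ ^ 2 * ‖ξ p‖ ^ 2) →
            A * ∑' p, ‖c p‖ ^ 2 * ‖ξ p‖ ^ 2 ≤ ‖∑' p, c p • ξ p‖ ^ 2 ∧
            ‖∑' p, c p • ξ p‖ ^ 2 ≤ B * ∑' p, ‖c p‖ ^ 2 * ‖ξ p‖ ^ 2) := by
  -- The constants 1 ∓ 1/2 come from the Schur bound 1/2 and are uniform in |q| < 1/40.
  refine ⟨1 / 40, by norm_num, fun q hq => ⟨1 / 2, 3 / 2, by norm_num, by norm_num, ?_⟩⟩
  intro V _ _ _ e he I b ξ hξ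
  refine ⟨?_, ?_, fun c => ?_⟩
  · rintro ⟨⟨k, i⟩, r, s⟩
    rw [hξ]
    exact QFock.sandwich_basis_ne_zero b he hq.le i r s
  · rw [QFock.closure_span_normalized_basis b he hq.le hξ, QFock.L2_gaussianAlgebra,
      QFock.L2_generatorSubalgebra he, top_inf_eq]
  · have hb := fun s => abs_le.1 (QFock.basis_sum_bounds b he hq.le hξ c s)
    have h1 : ∀ s : Finset ((Σ k, I k) × ℕ × ℕ),
        1 / 2 * ∑ p ∈ s, ‖c p • ξ p‖ ^ 2 ≤ ‖∑ p ∈ s, c p • ξ p‖ ^ 2 := fun s => by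
      linarith [(hb s).1]
    have h2 : ∀ s : Finset ((Σ k, I k) × ℕ × ℕ),
        ‖∑ p ∈ s, c p • ξ p‖ ^ 2 ≤ 3 / 2 * ∑ p ∈ s, ‖c p • ξ p‖ ^ 2 := fun s => by
      linarith [(hb s).2]
    have hn : (fun p => ‖c p‖ ^ 2 * ‖ξ p‖ ^ 2) = fun p => ‖c p • ξ p‖ ^ 2 := by
      funext p
      rw [norm_smul, mul_pow]
    have hiff := QFock.summable_iff_summable_norm_sq (by norm_num) (by norm_num) h1 h2
    rw [hn]
    exact ⟨hiff, fun hs => QFock.norm_sq_tsum_bounds h1 h2 (hiff.2 hs) hs⟩
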